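/- Let $G$ be a finite simple graph drawn in the plane without crossings (vertices are distinct points, edges are simple polygonal arcs between their ends that meet each other and the vertices only in common ends), and suppose that the drawing is a plane triangulation, i.e. every face, including the unbounded one, is bounded by a 3-cycle of $G$. Suppose that $G$ has minimum degree $5$ and that $G$ has no separating 3-cycle, i.e. there is no 3-cycle $C$ such that $G \setminus V(C)$ has at least two components. Then $G$ contains configuration $H$: there are an edge $uv$ of $G$ and distinct vertices $w \ne x$ such that $uvw$ and $uvx$ are 3-faces of the drawing (hence the two faces incident with $uv$), $d(w) = 5$ and $d(x) \le 6$. -/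

import Mathlib

/-- The plane. Only its affine structure and its topology are used below. -/
abbrev Plane : Type := ℝ × ℝ

/-- `A` is a polygonal (simple) arc with ends `p` and `q`: the union of the segments of a chain
`p = c 0, c 1, …, c n = q` with `n ≥ 1`, where two consecutive segments meet only in their common
corner, and two segments that are not consecutive are disjoint. -/
def IsPolygonalArc (A : Set Plane) (p q : Plane) : Prop :=
  ∃ (n : ℕ) (c : ℕ → Plane), 0 < n ∧ c 0 = p ∧ c n = q ∧
    (∀ i < n, c i ≠ c (i + 1)) ∧
    (∀ i, i + 1 < n →
      segment ℝ (c i) (c (i + 1)) ∩ segment ℝ (c (i + 1)) (c (i + 2)) = {c (i + 1)}) ∧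
    (∀ i j, i + 1 < j → j < n →
      Disjoint (segment ℝ (c i) (c (i + 1))) (segment ℝ (c j) (c (j + 1)))) ∧
    A = ⋃ i ∈ Set.Iio n, segment ℝ (c i) (c (i + 1))

/-- A drawing of the simple graph `G` in the plane without crossings: vertices are distinct
points, the edge `uv` is a polygonal arc between the points of `u` and `v` that contains no other
vertex, and two distinct edges meet only in common ends.
(The value of `arc` at a pair that is not an edge is irrelevant.) -/
structure PlaneDrawing {V : Type*} (G : SimpleGraph V) where
  point : V → Plane
  arc : Sym2 V → Set Plane
  point_injective : Function.Injective point
  isPolygonalArc : ∀ u v : V, G.Adj u v → IsPolygonalArc (arc s(u, v)) (point u) (point v)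
  vertex_on_arc : ∀ e ∈ G.edgeSet, ∀ w : V, point w ∈ arc e → w ∈ e
  arc_inter_arc : ∀ e ∈ G.edgeSet, ∀ f ∈ G.edgeSet, e ≠ f →
    arc e ∩ arc f ⊆ point '' {w | w ∈ e ∧ w ∈ f}

namespace PlaneDrawing

variable {V : Type*} {G : SimpleGraph V}

/-- The set of all points of the plane that lie on the drawing. -/
def support (D : PlaneDrawing G) : Set Plane :=
  Set.range D.point ∪ ⋃ e ∈ G.edgeSet, D.arc e

/-- The faces (the unbounded one included) are the connected components of the complement of
the drawing. -/
def IsFace (D : PlaneDrawing G) (F : Set Plane) : Prop :=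
  ∃ x ∈ D.supportᶜ, F = connectedComponentIn D.supportᶜ x

/-- `F` is the 3-face `uvw`: a face whose boundary is the 3-cycle `uvw` of `G`. -/
def IsThreeFace (D : PlaneDrawing G) (F : Set Plane) (u v w : V) : Prop :=
  D.IsFace F ∧ G.Adj u v ∧ G.Adj v w ∧ G.Adj u w ∧
    frontier F = D.arc s(u, v) ∪ D.arc s(v, w) ∪ D.arc s(u, w)

/-- A plane triangulation: every face is bounded by a 3-cycle. -/
def IsTriangulation (D : PlaneDrawing G) : Prop :=
  ∀ F : Set Plane, D.IsFace F → ∃ u v w : V, D.IsThreeFace F u v w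

/-- The drawing contains configuration `H`: an edge `uv` whose two incident faces are 3-faces
`uvw` and `uvx` with `w ≠ x`, `d(w) = 5` and `d(x) ≤ 6`. -/
def ContainsH [Fintype V] [DecidableRel G.Adj] (D : PlaneDrawing G) : Prop :=
  ∃ (u v w x : V) (F F' : Set Plane), F ≠ F' ∧ w ≠ x ∧
    D.IsThreeFace F u v w ∧ D.IsThreeFace F' u v x ∧ G.degree w = 5 ∧ G.degree x ≤ 6

end PlaneDrawing

/-- A vertex set `S` is separating if `G ∖ S` has at least two components. -/
def SimpleGraph.IsSeparatingSet {V : Type*} (G : SimpleGraph V) (S : Set V) : Prop :=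
  Nontrivial (G.induce Sᶜ).ConnectedComponent

/-- Some 3-cycle of `G` has a separating vertex set. -/
def SimpleGraph.HasSeparatingThreeCycle {V : Type*} (G : SimpleGraph V) : Prop :=
  ∃ a b c : V, G.Adj a b ∧ G.Adj b c ∧ G.Adj a c ∧ G.IsSeparatingSet {a, b, c}

/-!
The proof has a combinatorial and a topological half.

*Discharging.* Suppose that there is no configuration `H`: across an edge from a vertex of degree 5
there is always a vertex of degree at least 7 (`AvoidsH`). Give every vertex `v` the charge
`14 (d(v) - 6)`; by Euler's formula the sum is negative. A vertex `x` of degree at least 7 has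
charge at least `2 d(x)`, so it can send one unit through each of the `2 d(x)` ordered facial
triangles `xab`: to the vertex opposite to `x` across `ab` if that one has degree 5, else to an end
of `ab` of degree 5, else to the vertex opposite to `x` in the neighbouring triangle on `xa`
(`chargeTarget`). A vertex `w` of degree 5 lacks 14 units. It receives 10 across the five edges of
its link, as the opposite vertices have degree at least 7, and `fourteen_le` finds another 4: if
some vertex of the link does not have degree 6, then two triangles at `w` supply them, since
vertices at distance two in the link are opposite to each other; if all have degree 6, they come
through the triangles beyond the link (`mem_senders_of_six`). Hence the sum of the charges is not
negative, a contradiction (`not_avoidsH`). Only the fact that every edge lies in exactly two facial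
triangles with distinct third vertices is used (`IsTriangulatedSurface`): the links are then
2-regular, and so the link of a vertex of degree 5 is a 5-cycle.

*Topology.* For a cycle `z` modulo 2, count modulo 2 the crossings of `z` with the vertical ray
upwards from a point (`parity`). This function is locally constant off the drawing and changes by
`z e` across the edge `e` (`eventually_parity_eq`, `eventually_parity_side`), which replaces the
Jordan curve theorem. Applied to the boundary triangle of a face, it shows that the two sides of an
edge are different faces (`exists_two_faces`). If they had the same boundary triangle, the two faces
and the triangle would fill the plane, as the plane without finitely many points is connected, against the minimum degree
(`IsThreeFace.eq_of_same`). Finally, `parity` embeds the cycle space into the space of functions on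
the faces and misses the constant function 1, so that `|E| - |V| < |F|`; with `3 |F| = 2 |E|` this
gives `|E| < 3 |V|` (`card_edges_lt`), the form of Euler's formula that the discharging needs.
-/

/-! ### Facial triangles and links -/

/-- The combinatorial data of a closed triangulated surface on the graph `G`, up to the structure
at the vertices: `T u v w` says that `uvw` is a facial triangle, in any order of its vertices, and
every edge of `G` lies in exactly two facial triangles, which have distinct third vertices. -/
structure IsTriangulatedSurface {V : Type*} (G : SimpleGraph V) (T : V → V → V → Prop) :
    Prop where
  adj : ∀ {u v w}, T u v w → G.Adj u v
  swap : ∀ {u v w}, T u v w → T v u w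
  rot : ∀ {u v w}, T u v w → T v w u
  two : ∀ {u v}, G.Adj u v →
    ∃ w x, w ≠ x ∧ T u v w ∧ T u v x ∧ ∀ y, T u v y → y = w ∨ y = x

open Classical in
/-- The vertex opposite to `x` across the edge `ab` of a facial triangle `xab`. -/
noncomputable def oppositeVertex {V : Type*} (T : V → V → V → Prop) (x a b : V) : V :=
  if h : ∃ y, y ≠ x ∧ T y a b then h.choose else x

namespace IsTriangulatedSurface

variable {V : Type*} {G : SimpleGraph V} {T : V → V → V → Prop}

section Local

variable (hT : IsTriangulatedSurface G T)
include hT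

lemma rot' {u v w : V} (h : T u v w) : T w u v := hT.rot (hT.rot h)

lemma swap' {u v w : V} (h : T u v w) : T u w v := hT.swap (hT.rot' h)

lemma rev {u v w : V} (h : T u v w) : T w v u := hT.swap (hT.rot h)

lemma adj' {u v w : V} (h : T u v w) : G.Adj u w := hT.adj (hT.swap' h)

lemma adj'' {u v w : V} (h : T u v w) : G.Adj v w := hT.adj (hT.rot h)

lemma eq_or_eq {a b x y z : V} (hxy : x ≠ y) (hx : T x a b) (hy : T y a b) (hz : T z a b) :
    z = x ∨ z = y := by
  obtain ⟨p, q, -, -, -, h⟩ := hT.two (hT.adj'' hx)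
  have := h _ (hT.rot hx)
  have := h _ (hT.rot hy)
  have := h _ (hT.rot hz)
  grind

lemma exists_opposite {x a b : V} (hx : T x a b) : ∃ y, y ≠ x ∧ T y a b := by
  obtain ⟨p, q, hpq, hp, hq, h⟩ := hT.two (hT.adj'' hx)
  rcases h _ (hT.rot hx) with rfl | rfl
  · exact ⟨q, hpq.symm, hT.rot' hq⟩
  · exact ⟨p, hpq, hT.rot' hp⟩

lemma oppositeVertex_spec {x a b : V} (hx : T x a b) :
    oppositeVertex T x a b ≠ x ∧ T (oppositeVertex T x a b) a b := by
  have h := hT.exists_opposite hx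
  rw [oppositeVertex, dif_pos h]
  exact h.choose_spec

lemma oppositeVertex_eq {x y a b : V} (hx : T x a b) (hy : T y a b) (hyx : y ≠ x) :
    oppositeVertex T x a b = y := by
  obtain ⟨h1, h2⟩ := hT.oppositeVertex_spec hx
  exact (hT.eq_or_eq hyx.symm hx hy h2).resolve_left h1

end Local

section Link

variable [Fintype V] [DecidableRel G.Adj] (hT : IsTriangulatedSurface G T)
include hT

/-- A union `S` of components of the link of `a` leaves out either nothing or at least three
neighbours, as the link is 2-regular. -/
lemma eq_neighborFinset_or_three_le [DecidableEq V] {a : V} {S : Finset V}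
    (hS : ∀ p ∈ S, ∀ q, T a p q → q ∈ S) :
    G.neighborFinset a ⊆ S ∨ 3 ≤ (G.neighborFinset a \ S).card := by
  by_cases h : G.neighborFinset a ⊆ S
  · exact .inl h
  right
  obtain ⟨p, hp, hpS⟩ := Finset.not_subset.1 h
  obtain ⟨x, y, hxy, hx, hy, -⟩ := hT.two ((G.mem_neighborFinset _ _).1 hp)
  have hpx : p ≠ x := (hT.adj'' hx).ne
  have hpy : p ≠ y := (hT.adj'' hy).ne
  have : ({p, x, y} : Finset V) ⊆ G.neighborFinset a \ S := by
    intro t ht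
    simp only [Finset.mem_insert, Finset.mem_singleton] at ht
    rw [Finset.mem_sdiff, G.mem_neighborFinset]
    rcases ht with rfl | rfl | rfl
    · exact ⟨(G.mem_neighborFinset _ _).1 hp, hpS⟩
    · exact ⟨hT.adj' hx, fun h => hpS (hS _ h _ (hT.swap' hx))⟩
    · exact ⟨hT.adj' hy, fun h => hpS (hS _ h _ (hT.swap' hy))⟩
  calc 3 = ({p, x, y} : Finset V).card := by
        rw [Finset.card_eq_three.2 ⟨p, x, y, hpx, hpy, hxy, rfl⟩]
    _ ≤ _ := Finset.card_le_card this

/-- A union of components of the link of `a` with more than `d(a) - 3` vertices is the whole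
link. -/
lemma mem_of_adj_of_closed [DecidableEq V] {a : V} {S : Finset V}
    (hS : ∀ p ∈ S, ∀ q, T a p q → q ∈ S) (hSa : S ⊆ G.neighborFinset a)
    (hcard : G.degree a < S.card + 3) {t : V} (ht : G.Adj a t) : t ∈ S := by
  rcases hT.eq_neighborFinset_or_three_le hS with h | h
  · exact h ((G.mem_neighborFinset _ _).2 ht)
  · rw [Finset.card_sdiff_of_subset hSa, G.card_neighborFinset_eq_degree] at h
    omega

end Link

end IsTriangulatedSurface

/-- `v₀v₁v₂v₃v₄` is the link of `w`. -/
structure IsFiveLink {V : Type*} (T : V → V → V → Prop) (w v₀ v₁ v₂ v₃ v₄ : V) : Prop where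
  nodup : [v₀, v₁, v₂, v₃, v₄].Nodup
  t₀ : T w v₀ v₁
  t₁ : T w v₁ v₂
  t₂ : T w v₂ v₃
  t₃ : T w v₃ v₄
  t₄ : T w v₄ v₀

namespace IsFiveLink

variable {V : Type*} {G : SimpleGraph V} {T : V → V → V → Prop} {w v₀ v₁ v₂ v₃ v₄ : V}

lemma rotate (h : IsFiveLink T w v₀ v₁ v₂ v₃ v₄) : IsFiveLink T w v₁ v₂ v₃ v₄ v₀ :=
  ⟨by have := h.nodup; grind, h.t₁, h.t₂, h.t₃, h.t₄, h.t₀⟩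

lemma reflect (hT : IsTriangulatedSurface G T) (h : IsFiveLink T w v₀ v₁ v₂ v₃ v₄) :
    IsFiveLink T w v₀ v₄ v₃ v₂ v₁ :=
  ⟨by have := h.nodup; grind, hT.swap' h.t₄, hT.swap' h.t₃, hT.swap' h.t₂, hT.swap' h.t₁,
    hT.swap' h.t₀⟩

end IsFiveLink

namespace IsTriangulatedSurface

variable {V : Type*} {G : SimpleGraph V} {T : V → V → V → Prop}
variable [Fintype V] [DecidableRel G.Adj]

/-- The link of a vertex of degree 5 is a 5-cycle, as a 2-regular simple graph on five vertices. -/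
lemma exists_isFiveLink (hT : IsTriangulatedSurface G T) {w : V} (hw : G.degree w = 5) :
    ∃ v₀ v₁ v₂ v₃ v₄, IsFiveLink T w v₀ v₁ v₂ v₃ v₄ := by
  classical
  have nx : ∀ {p q}, T w p q → ∃ r, r ≠ p ∧ T w q r ∧ ∀ s, T w q s → s = p ∨ s = r := by
    intro p q h
    obtain ⟨r, hr, hr'⟩ := hT.exists_opposite (hT.swap h)
    exact ⟨r, hr, hT.rot hr', fun s hs => hT.eq_or_eq hr.symm (hT.swap h) hr' (hT.rot' hs)⟩
  obtain ⟨v₀, h₀⟩ : ∃ v, G.Adj w v := by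
    rw [← G.degree_pos_iff_exists_adj]
    omega
  obtain ⟨v₁, v₄, h14, h01, h04, u₀⟩ := hT.two h₀
  obtain ⟨v₂, h20, h12, u₁⟩ := nx h01
  obtain ⟨v₃, h31, h23, u₂⟩ := nx h12
  obtain ⟨v₅, h50, h45, u₄⟩ := nx h04
  have n01 := (hT.adj'' h01).ne
  have n04 := (hT.adj'' h04).ne
  have n12 := (hT.adj'' h12).ne
  have n23 := (hT.adj'' h23).ne
  have n45 := (hT.adj'' h45).ne
  have sub : ∀ {S : Finset V}, (∀ p ∈ S, ∃ q, T w p q) → S ⊆ G.neighborFinset w := by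
    intro S h p hp
    obtain ⟨q, hq⟩ := h p hp
    exact (G.mem_neighborFinset _ _).2 (hT.adj hq)
  -- A closed set of three or four vertices would leave out one or two vertices of the link.
  have key : ∀ {S : Finset V}, (∀ p ∈ S, ∃ q, T w p q) →
      (∀ p ∈ S, ∀ q, T w p q → q ∈ S) → 3 ≤ S.card → 5 ≤ S.card := by
    intro S h1 h2 h3
    have : G.neighborFinset w ⊆ S := fun t ht =>
      hT.mem_of_adj_of_closed h2 (sub h1) (by omega) ((G.mem_neighborFinset _ _).1 ht)
    have := Finset.card_le_card this
    rwa [G.card_neighborFinset_eq_degree, hw] at this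
  have n24 : v₂ ≠ v₄ := by
    rintro rfl
    have := @key {v₀, v₁, v₂} (by
      simp only [Finset.mem_insert, Finset.mem_singleton]
      rintro p (rfl | rfl | rfl)
      exacts [⟨_, h01⟩, ⟨_, h12⟩, ⟨_, h23⟩]) (by
      have := u₄ _ (hT.swap' h12)
      simp only [Finset.mem_insert, Finset.mem_singleton]
      rintro p (rfl | rfl | rfl) q hq <;> grind) (by
      rw [Finset.card_eq_three.2 ⟨v₀, v₁, v₂, by grind, by grind, by grind, rfl⟩])
    have := this.trans Finset.card_le_three
    omega
  have n30 : v₃ ≠ v₀ := by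
    rintro rfl
    have := u₀ _ (hT.swap' h23)
    grind
  have n34 : v₃ ≠ v₄ := by
    rintro rfl
    have := @key {v₀, v₁, v₂, v₃} (by
      simp only [Finset.mem_insert, Finset.mem_singleton]
      rintro p (rfl | rfl | rfl | rfl)
      exacts [⟨_, h01⟩, ⟨_, h12⟩, ⟨_, h23⟩, ⟨_, h45⟩]) (by
      have := u₄ _ (hT.swap' h23)
      simp only [Finset.mem_insert, Finset.mem_singleton]
      rintro p (rfl | rfl | rfl | rfl) q hq <;> grind) (by
      calc 3 = ({v₁, v₂, v₃} : Finset V).card := by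
            rw [Finset.card_eq_three.2 ⟨v₁, v₂, v₃, by grind, by grind, by grind, rfl⟩]
        _ ≤ _ := Finset.card_le_card (by grind))
    have := this.trans Finset.card_le_four
    omega
  have hnd : [v₀, v₁, v₂, v₃, v₄].Nodup := by grind
  have hS : ({v₀, v₁, v₂, v₃, v₄} : Finset V) = G.neighborFinset w := by
    refine Finset.eq_of_subset_of_card_le (sub ?_) ?_
    · simp only [Finset.mem_insert, Finset.mem_singleton]
      rintro p (rfl | rfl | rfl | rfl | rfl)
      exacts [⟨_, h01⟩, ⟨_, h12⟩, ⟨_, h23⟩, ⟨_, hT.swap' h23⟩, ⟨_, h45⟩]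
    · rw [G.card_neighborFinset_eq_degree, hw]
      exact (List.toFinset_card_of_nodup hnd).symm.le.trans (Finset.card_le_card (by simp))
  have h5 : v₅ ∈ ({v₀, v₁, v₂, v₃, v₄} : Finset V) := by
    rw [hS, G.mem_neighborFinset]
    exact hT.adj' h45
  have h53 : v₅ = v₃ := by
    simp only [Finset.mem_insert, Finset.mem_singleton] at h5
    rcases h5 with h | h | h | h | h
    · exact absurd h h50
    · subst h
      have := u₁ _ (hT.swap' h45)
      grind
    · subst h
      have := u₂ _ (hT.swap' h45)
      grind
    · exact h
    · exact absurd h.symm n45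
  subst h53
  exact ⟨v₀, v₁, v₂, v₅, v₄, hnd, h01, h12, h23, hT.swap' h45, hT.swap' h04⟩

end IsTriangulatedSurface

/-! ### Discharging -/

open Classical in
/-- The vertex that receives the charge sent by `x` through the corner `xab`, in the direction
from `a` to `b`: the vertex opposite to `x` if it has degree 5, else an end of `ab` of degree 5 if
there is one, else the vertex opposite to `x` in the corner next to `xab` along `xa`. -/
noncomputable def chargeTarget {V : Type*} (T : V → V → V → Prop) (d : V → ℕ)
    (f : V × V × V) : V :=
  if d (oppositeVertex T f.1 f.2.1 f.2.2) = 5 then oppositeVertex T f.1 f.2.1 f.2.2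
  else if d f.2.1 = 5 then f.2.1
  else if d f.2.2 = 5 then f.2.2
  else oppositeVertex T f.1 f.2.1 (oppositeVertex T f.2.2 f.1 f.2.1)

namespace IsTriangulatedSurface

variable {V : Type*} {G : SimpleGraph V} {T : V → V → V → Prop}
variable [Fintype V] [DecidableRel G.Adj]

open Classical in
/-- The number of ordered facial triangles at `x` is `2 d(x)`. -/
lemma card_filter_pairs (hT : IsTriangulatedSurface G T) (x : V) :
    (Finset.univ.filter fun p : V × V => T x p.1 p.2).card = 2 * G.degree x := by
  have h : ∀ p ∈ Finset.univ.filter (fun p : V × V => T x p.1 p.2),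
      p.1 ∈ G.neighborFinset x := by
    intro p hp
    exact (G.mem_neighborFinset _ _).2 (hT.adj (Finset.mem_filter.1 hp).2)
  rw [Finset.card_eq_sum_card_fiberwise h, ← G.card_neighborFinset_eq_degree, mul_comm,
    ← smul_eq_mul, ← Finset.sum_const]
  refine Finset.sum_congr rfl fun a ha => ?_
  obtain ⟨p, q, hpq, hp, hq, h⟩ := hT.two ((G.mem_neighborFinset _ _).1 ha)
  rw [Finset.card_eq_two]
  refine ⟨(a, p), (a, q), by simpa using hpq, ?_⟩
  ext ⟨y, z⟩
  simp only [Finset.mem_filter, Finset.mem_univ, true_and, Finset.mem_insert,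
    Finset.mem_singleton, Prod.mk.injEq]
  constructor
  · rintro ⟨h1, rfl⟩
    have := h _ h1
    tauto
  · rintro (⟨rfl, rfl⟩ | ⟨rfl, rfl⟩)
    exacts [⟨hp, rfl⟩, ⟨hq, rfl⟩]

open Classical in
/-- The ordered facial triangles through which a vertex of degree at least 7 sends charge
to `w`. -/
noncomputable def senders (G : SimpleGraph V) [DecidableRel G.Adj] (T : V → V → V → Prop) (w : V) :
    Finset (V × V × V) :=
  Finset.univ.filter fun f => T f.1 f.2.1 f.2.2 ∧ 7 ≤ G.degree f.1 ∧
    chargeTarget T (fun v => G.degree v) f = w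

/-- Across an edge from a vertex of degree 5 there is a vertex of degree at least 7. This is what
the absence of configuration `H` says. -/
def AvoidsH (G : SimpleGraph V) [DecidableRel G.Adj] (T : V → V → V → Prop) : Prop :=
  ∀ u v w x, w ≠ x → T u v w → T u v x → G.degree w = 5 → 7 ≤ G.degree x

omit [Fintype V] [DecidableRel G.Adj] in
lemma oppositeVertex_link (hT : IsTriangulatedSurface G T) {w v₀ v₁ v₂ v₃ v₄ : V}
    (h : IsFiveLink T w v₀ v₁ v₂ v₃ v₄) : oppositeVertex T v₀ w v₁ = v₂ :=
  hT.oppositeVertex_eq (hT.swap h.t₀) (hT.rot' h.t₁) (by have := h.nodup; grind)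

/-- Two vertices at distance two in the link of `w` lie opposite to each other across an edge
at `w`. -/
lemma AvoidsH.seven_le (hH : AvoidsH G T) (hT : IsTriangulatedSurface G T) {w v₀ v₁ v₂ v₃ v₄ : V}
    (h : IsFiveLink T w v₀ v₁ v₂ v₃ v₄) (h0 : G.degree v₀ = 5) : 7 ≤ G.degree v₂ :=
  hH w v₁ v₀ v₂ (by have := h.nodup; grind) (hT.swap' h.t₀) h.t₁ h0

section Counting

variable (hT : IsTriangulatedSurface G T) (hH : AvoidsH G T) {w : V} (hw : G.degree w = 5)
include hT hH hw

open Classical in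
/-- A vertex `w` of degree 5 receives charge through each of the ten ordered facial triangles on
the other side of the edges of its link, so four more suffice. -/
lemma fourteen_le_card_senders (S : Finset (V × V × V)) (hS : 4 ≤ S.card)
    (hS' : S ⊆ senders G T w)
    (hS5 : ∀ f ∈ S, G.degree (oppositeVertex T f.1 f.2.1 f.2.2) ≠ 5) :
    14 ≤ (senders G T w).card := by
  set R : Finset (V × V × V) := (Finset.univ.filter fun p : V × V => T w p.1 p.2).image
    fun p => (oppositeVertex T w p.1 p.2, p.1, p.2) with hR
  have hRc : R.card = 10 := by
    rw [hR, Finset.card_image_of_injective, hT.card_filter_pairs, hw]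
    rintro ⟨a, b⟩ ⟨c, d⟩ h
    simp only [Prod.mk.injEq] at h
    exact Prod.ext h.2.1 h.2.2
  have hRo : ∀ f ∈ R, T f.1 f.2.1 f.2.2 ∧ 7 ≤ G.degree f.1 ∧
      oppositeVertex T f.1 f.2.1 f.2.2 = w := by
    intro f hf
    obtain ⟨⟨a, b⟩, hab, rfl⟩ := Finset.mem_image.1 hf
    have hab : T w a b := (Finset.mem_filter.1 hab).2
    obtain ⟨h1, h2⟩ := hT.oppositeVertex_spec hab
    exact ⟨h2, hH a b w _ h1.symm (hT.rot hab) (hT.rot h2) hw,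
      hT.oppositeVertex_eq h2 hab h1.symm⟩
  have hdisj : Disjoint R S := by
    rw [Finset.disjoint_left]
    intro f hf hf'
    exact hS5 f hf' (by rw [(hRo f hf).2.2, hw])
  calc 14 ≤ (R ∪ S).card := by
        rw [Finset.card_union_of_disjoint hdisj, hRc]
        omega
    _ ≤ _ := by
      refine Finset.card_le_card (Finset.union_subset (fun f hf => ?_) hS')
      obtain ⟨h1, h2, h3⟩ := hRo f hf
      refine Finset.mem_filter.2 ⟨Finset.mem_univ _, h1, h2, ?_⟩
      rw [chargeTarget, if_pos (by rw [h3, hw]), h3]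

open Classical in
/-- Two corners `xwb`, `x'wb'` from which no charge crosses the edges `wb`, `wb'` supply the missing
four ordered triangles. -/
lemma fourteen_le_of_corners {x b x' b' : V} (h : T x w b) (h' : T x' w b')
    (hx : 7 ≤ G.degree x) (hx' : 7 ≤ G.degree x') (hb : 6 ≤ G.degree b) (hb' : 6 ≤ G.degree b')
    (ho : G.degree (oppositeVertex T x w b) ≠ 5) (ho' : G.degree (oppositeVertex T x' w b') ≠ 5)
    (hne : (x, b) ≠ (x', b')) : 14 ≤ (senders G T w).card := by
  have opp_swap : ∀ {x b}, T x w b → oppositeVertex T x b w = oppositeVertex T x w b := by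
    intro x b h
    obtain ⟨h1, h2⟩ := hT.oppositeVertex_spec h
    exact hT.oppositeVertex_eq (hT.swap' h) (hT.swap' h2) h1
  have mem : ∀ {x b}, T x w b → 7 ≤ G.degree x → 6 ≤ G.degree b →
      G.degree (oppositeVertex T x w b) ≠ 5 →
      (x, w, b) ∈ senders G T w ∧ (x, b, w) ∈ senders G T w := by
    intro x b h hx hb ho
    constructor
    · refine Finset.mem_filter.2 ⟨Finset.mem_univ _, h, hx, ?_⟩
      rw [chargeTarget, if_neg ho, if_pos hw]
    · refine Finset.mem_filter.2 ⟨Finset.mem_univ _, hT.swap' h, hx, ?_⟩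
      rw [chargeTarget, if_neg (by rwa [opp_swap h]), if_neg (by dsimp only; omega), if_pos hw]
  have nb : w ≠ b := by rintro rfl; omega
  have nb' : w ≠ b' := by rintro rfl; omega
  refine fourteen_le_card_senders hT hH hw
    [(x, w, b), (x, b, w), (x', w, b'), (x', b', w)].toFinset ?_ ?_ ?_
  · rw [List.toFinset_card_of_nodup (by grind)]
    rfl
  · intro f hf
    simp only [List.mem_toFinset, List.mem_cons, List.not_mem_nil, or_false] at hf
    have := mem h hx hb ho
    have := mem h' hx' hb' ho'
    rcases hf with rfl | rfl | rfl | rfl <;> tauto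
  · intro f hf
    simp only [List.mem_toFinset, List.mem_cons, List.not_mem_nil, or_false] at hf
    rcases hf with rfl | rfl | rfl | rfl
    · exact ho
    · rwa [opp_swap h]
    · exact ho'
    · rwa [opp_swap h']

omit hw in
/-- If `p w q` is a path in the link of a vertex `a` of degree 6 with `d(w) = 5` and
`d(p) = d(q) = 6`, and `x` follows `p` in the link, then charge is sent to `w` through the
triangle on the edge `ax` that does not contain `p`. -/
lemma mem_senders_of_six {a p q w : V} (hw : G.degree w = 5) (ha : G.degree a = 6)
    (hp : G.degree p = 6) (hq : G.degree q = 6) (hpq : p ≠ q) (hap : T w a p) (haq : T w a q) :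
    ∃ f ∈ senders G T w, f.2.1 = a ∧ G.degree (oppositeVertex T f.1 f.2.1 f.2.2) ≠ 5 := by
  classical
  obtain ⟨hxw, hx⟩ := hT.oppositeVertex_spec hap
  obtain ⟨hxw', hx'⟩ := hT.oppositeVertex_spec haq
  set x := oppositeVertex T w a p
  set x' := oppositeVertex T w a q
  have dx : 7 ≤ G.degree x := hH a p w x hxw.symm (hT.rot hap) (hT.rot hx) hw
  have dx' : 7 ≤ G.degree x' := hH a q w x' hxw'.symm (hT.rot haq) (hT.rot hx') hw
  obtain ⟨hzp, hz⟩ := hT.oppositeVertex_spec (hT.rot' hx : T p x a)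
  set z := oppositeVertex T p x a with hzdef
  have dz : G.degree z ≠ 5 := by
    intro h
    have := hH x a z p hzp (hT.rot hz) (hT.rot (hT.rot' hx)) h
    omega
  have hxaz : T x a z := hT.rot hz
  obtain ⟨hyx, hy⟩ := hT.oppositeVertex_spec hxaz
  set y := oppositeVertex T x a z with hydef
  -- The neighbours of `p`, `w`, `q`, `x`, `x'`, `z` in the link of `a`.
  have lw : ∀ t, T a w t → t = p ∨ t = q := fun t ht =>
    hT.eq_or_eq hpq (hT.rev hap) (hT.rev haq) (hT.rot' ht)
  have lp : ∀ t, T a p t → t = w ∨ t = x := fun t ht =>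
    hT.eq_or_eq hxw.symm hap hx (hT.rot' ht)
  have lq : ∀ t, T a q t → t = w ∨ t = x' := fun t ht =>
    hT.eq_or_eq hxw'.symm haq hx' (hT.rot' ht)
  have lx : ∀ t, T a x t → t = p ∨ t = z := fun t ht =>
    hT.eq_or_eq hzp.symm (hT.rev hx) (hT.swap' hz) (hT.rot' ht)
  have haxz : T a x z := hT.swap hxaz
  have hax'q : T a x' q := hT.swap hx'
  have adj_mem : ∀ {S : Finset V}, (∀ t ∈ S, G.Adj a t) → S ⊆ G.neighborFinset a :=
    fun h t ht => (G.mem_neighborFinset _ _).2 (h t ht)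
  -- A closed set of four or five vertices would leave out one or two vertices of the link.
  have not_closed : ∀ {S : Finset V}, (∀ t ∈ S, G.Adj a t) → 4 ≤ S.card → S.card ≤ 5 →
      ¬ ∀ t ∈ S, ∀ s, T a t s → s ∈ S := by
    intro S h1 h2 h3 h4
    have : G.neighborFinset a ⊆ S := fun t ht =>
      hT.mem_of_adj_of_closed h4 (adj_mem h1) (by omega) ((G.mem_neighborFinset _ _).1 ht)
    have := Finset.card_le_card this
    rw [G.card_neighborFinset_eq_degree] at this
    omega
  have aw : G.Adj a w := (hT.adj hap).symm
  have ap : G.Adj a p := hT.adj'' hap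
  have aq : G.Adj a q := hT.adj'' haq
  have ax : G.Adj a x := (hT.adj hx).symm
  have ax' : G.Adj a x' := (hT.adj hx').symm
  have az : G.Adj a z := hT.adj'' hxaz
  have nwp : w ≠ p := by rintro h; rw [h] at hw; omega
  have nwq : w ≠ q := by rintro h; rw [h] at hw; omega
  have nxp : x ≠ p := by intro h; rw [h] at dx; omega
  have nxq : x ≠ q := by intro h; rw [h] at dx; omega
  have nxp' : x' ≠ p := by intro h; rw [h] at dx'; omega
  have nxq' : x' ≠ q := by intro h; rw [h] at dx'; omega
  have hxx : x ≠ x' := by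
    intro h
    have hzq := lx q (h ▸ hax'q)
    refine @not_closed [p, w, q, x].toFinset ?_ ?_ ?_ ?_
    · simp [ap, aw, aq, ax]
    · rw [List.toFinset_card_of_nodup (by grind)]
      rfl
    · exact (List.toFinset_card_le _).trans (by simp)
    · simp only [List.mem_toFinset]
      intro t ht s hs
      grind
  have hzq : z ≠ q := by
    intro h
    have := lq x (h ▸ hT.swap' haxz)
    grind
  have nzx : z ≠ x := (hT.adj' hxaz).ne'
  have nzw : z ≠ w := by intro h; rw [h] at dz; exact dz hw
  have hzx' : z ≠ x' := by
    intro h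
    have lx' : ∀ t, T a x' t → t = q ∨ t = x := fun t ht =>
      hT.eq_or_eq nxq.symm (hT.rev hx') (hT.rot' (hT.swap' (h ▸ haxz))) (hT.rot' ht)
    refine @not_closed [p, w, q, x, x'].toFinset ?_ ?_ ?_ ?_
    · simp [ap, aw, aq, ax, ax']
    · rw [List.toFinset_card_of_nodup (by grind)]
      simp
    · exact (List.toFinset_card_le _).trans (by simp)
    · simp only [List.mem_toFinset]
      intro t ht s hs
      grind
  have hN : [p, w, q, x, x', z].toFinset = G.neighborFinset a := by
    refine Finset.eq_of_subset_of_card_le (adj_mem ?_) ?_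
    · simp [ap, aw, aq, ax, ax', az]
    · rw [G.card_neighborFinset_eq_degree, ha, List.toFinset_card_of_nodup (by grind)]
      rfl
  have dy : G.degree y ≠ 5 := by
    intro h
    have hyN : y ∈ G.neighborFinset a := (G.mem_neighborFinset _ _).2 (hT.adj hy).symm
    rw [← hN] at hyN
    simp only [List.mem_toFinset, List.mem_cons, List.not_mem_nil, or_false] at hyN
    rcases hyN with e | e | e | e | e | e
    · rw [e] at h; omega
    · have := lw z (by rw [← e]; exact hT.swap hy)
      grind
    · rw [e] at h; omega
    · rw [e] at h; omega
    · rw [e] at h; omega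
    · rw [e] at h; omega
  refine ⟨(x, a, z), Finset.mem_filter.2 ⟨Finset.mem_univ _, hxaz, dx, ?_⟩, rfl, dy⟩
  rw [chargeTarget, if_neg dy, if_neg (by dsimp only; omega), if_neg dz]
  dsimp only
  rw [hT.oppositeVertex_eq hz (hT.rot' hx) hzp.symm, hT.oppositeVertex_eq hx hap hxw.symm]

omit hw in
/-- If the link of `w` has two adjacent vertices of degree 5, then `w` receives enough charge. -/
lemma fourteen_le_of_five_five (hw : G.degree w = 5) {v₀ v₁ v₂ v₃ v₄ : V}
    (h : IsFiveLink T w v₀ v₁ v₂ v₃ v₄) (h0 : G.degree v₀ = 5) (h1 : G.degree v₁ = 5) :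
    14 ≤ (senders G T w).card := by
  have d2 := hH.seven_le hT h h0
  have d3 := hH.seven_le hT h.rotate h1
  have d4 := hH.seven_le hT (h.rotate.reflect hT) h1
  refine fourteen_le_of_corners hT hH hw (hT.swap h.t₂) (hT.swap (hT.swap' h.t₃)) d2 d4
    (by omega) (by omega) ?_ ?_ (by have := h.nodup; grind)
  · rw [hT.oppositeVertex_link h.rotate.rotate]
    omega
  · rw [hT.oppositeVertex_link (h.reflect hT).rotate]
    omega

omit hw in
/-- If the link of `w` has a vertex of degree 5, then `w` receives enough charge. -/
lemma fourteen_le_of_five (hw : G.degree w = 5)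
    {v₀ v₁ v₂ v₃ v₄ : V} (h : IsFiveLink T w v₀ v₁ v₂ v₃ v₄) (h0 : G.degree v₀ = 5) :
    14 ≤ (senders G T w).card := by
  by_cases h1 : G.degree v₁ = 5
  · exact fourteen_le_of_five_five hT hH hw h h0 h1
  by_cases h4 : G.degree v₄ = 5
  · exact fourteen_le_of_five_five hT hH hw (h.reflect hT) h0 h4
  have d2 := hH.seven_le hT h h0
  have d3 := hH.seven_le hT (h.reflect hT) h0
  refine fourteen_le_of_corners hT hH hw (hT.swap h.t₂) (hT.swap (hT.swap' h.t₂)) d2 d3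
    (by omega) (by omega) ?_ ?_ (by have := h.nodup; grind)
  · rwa [hT.oppositeVertex_link h.rotate.rotate]
  · rwa [hT.oppositeVertex_link (h.reflect hT).rotate.rotate]

omit hw in
/-- If the link of `w` has no vertex of degree 5 but one of degree at least 7, then `w` receives
enough charge. -/
lemma fourteen_le_of_seven (hw : G.degree w = 5)
    {v₀ v₁ v₂ v₃ v₄ : V} (h : IsFiveLink T w v₀ v₁ v₂ v₃ v₄) (h0 : 7 ≤ G.degree v₀)
    (h1 : 6 ≤ G.degree v₁) (h2 : 6 ≤ G.degree v₂) (h3 : 6 ≤ G.degree v₃)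
    (h4 : 6 ≤ G.degree v₄) : 14 ≤ (senders G T w).card := by
  refine fourteen_le_of_corners hT hH hw (hT.swap h.t₀) (hT.swap (hT.swap' h.t₄)) h0 h0 h1 h4
    ?_ ?_ (by have := h.nodup; grind)
  · rw [hT.oppositeVertex_link h]
    omega
  · rw [hT.oppositeVertex_link (h.reflect hT)]
    omega

omit hw in
/-- If all vertices of the link of `w` have degree 6, then `w` receives enough charge. -/
lemma fourteen_le_of_six (hw : G.degree w = 5)
    {v₀ v₁ v₂ v₃ v₄ : V} (h : IsFiveLink T w v₀ v₁ v₂ v₃ v₄) (h0 : G.degree v₀ = 6)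
    (h1 : G.degree v₁ = 6) (h2 : G.degree v₂ = 6) (h3 : G.degree v₃ = 6)
    (h4 : G.degree v₄ = 6) : 14 ≤ (senders G T w).card := by
  classical
  have hnd := h.nodup
  obtain ⟨f₀, m₀, e₀, o₀⟩ := mem_senders_of_six hT hH hw h0 h1 h4 (by grind) h.t₀
    (hT.swap' h.t₄)
  obtain ⟨f₁, m₁, e₁, o₁⟩ := mem_senders_of_six hT hH hw h1 h2 h0 (by grind) h.t₁
    (hT.swap' h.t₀)
  obtain ⟨f₂, m₂, e₂, o₂⟩ := mem_senders_of_six hT hH hw h2 h3 h1 (by grind) h.t₂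
    (hT.swap' h.t₁)
  obtain ⟨f₃, m₃, e₃, o₃⟩ := mem_senders_of_six hT hH hw h3 h4 h2 (by grind) h.t₃
    (hT.swap' h.t₂)
  refine fourteen_le_card_senders hT hH hw [f₀, f₁, f₂, f₃].toFinset ?_ ?_ ?_
  · rw [List.toFinset_card_of_nodup]
    · rfl
    · refine List.Nodup.of_map (fun f => f.2.1) ?_
      simp only [List.map_cons, List.map_nil, e₀, e₁, e₂, e₃]
      grind
  · intro f hf
    simp only [List.mem_toFinset, List.mem_cons, List.not_mem_nil, or_false] at hf
    rcases hf with rfl | rfl | rfl | rfl <;> assumption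
  · intro f hf
    simp only [List.mem_toFinset, List.mem_cons, List.not_mem_nil, or_false] at hf
    rcases hf with rfl | rfl | rfl | rfl <;> assumption

end Counting

/-- Without configuration `H`, every vertex of degree 5 receives the 14 units of charge it lacks. -/
theorem fourteen_le (hT : IsTriangulatedSurface G T) (hH : AvoidsH G T)
    (hmin : ∀ v, 5 ≤ G.degree v) {w : V} (hw : G.degree w = 5) :
    14 ≤ (senders G T w).card := by
  obtain ⟨v₀, v₁, v₂, v₃, v₄, h⟩ := hT.exists_isFiveLink hw
  by_cases h0 : G.degree v₀ = 5
  · exact fourteen_le_of_five hT hH hw h h0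
  by_cases h1 : G.degree v₁ = 5
  · exact fourteen_le_of_five hT hH hw h.rotate h1
  by_cases h2 : G.degree v₂ = 5
  · exact fourteen_le_of_five hT hH hw h.rotate.rotate h2
  by_cases h3 : G.degree v₃ = 5
  · exact fourteen_le_of_five hT hH hw h.rotate.rotate.rotate h3
  by_cases h4 : G.degree v₄ = 5
  · exact fourteen_le_of_five hT hH hw h.rotate.rotate.rotate.rotate h4
  have six : ∀ v, G.degree v ≠ 5 → 6 ≤ G.degree v := fun v hv => by
    have := hmin v
    omega
  have g0 := six _ h0
  have g1 := six _ h1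
  have g2 := six _ h2
  have g3 := six _ h3
  have g4 := six _ h4
  by_cases k0 : 7 ≤ G.degree v₀
  · exact fourteen_le_of_seven hT hH hw h k0 g1 g2 g3 g4
  by_cases k1 : 7 ≤ G.degree v₁
  · exact fourteen_le_of_seven hT hH hw h.rotate k1 g2 g3 g4 g0
  by_cases k2 : 7 ≤ G.degree v₂
  · exact fourteen_le_of_seven hT hH hw h.rotate.rotate k2 g3 g4 g0 g1
  by_cases k3 : 7 ≤ G.degree v₃
  · exact fourteen_le_of_seven hT hH hw h.rotate.rotate.rotate k3 g4 g0 g1 g2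
  by_cases k4 : 7 ≤ G.degree v₄
  · exact fourteen_le_of_seven hT hH hw h.rotate.rotate.rotate.rotate k4 g0 g1 g2 g3
  exact fourteen_le_of_six hT hH hw h (by omega) (by omega) (by omega) (by omega) (by omega)

/-- The discharging argument. Give each vertex `v` the charge `14 (d(v) - 6)`. A vertex `x` of
degree at least 7 has at least `2 d(x)` of it, one unit for each ordered facial triangle at `x`,
and sends these units to their targets; then no vertex is left with a negative charge. -/
theorem not_avoidsH (hT : IsTriangulatedSurface G T)
    (hmin : ∀ v, 5 ≤ G.degree v) (hsum : ∑ v, G.degree v < 6 * Fintype.card V) :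
    ¬ AvoidsH G T := by
  classical
  intro hH
  set W := Finset.univ.filter fun v : V => G.degree v = 5
  set X := Finset.univ.filter fun v : V => 7 ≤ G.degree v
  set F : Finset (V × V × V) := Finset.univ.filter fun f => T f.1 f.2.1 f.2.2 ∧ 7 ≤ G.degree f.1
  have hF : F.card = ∑ x ∈ X, 2 * G.degree x := by
    have h : ∀ f ∈ F, f.1 ∈ X := fun f hf =>
      Finset.mem_filter.2 ⟨Finset.mem_univ _, (Finset.mem_filter.1 hf).2.2⟩
    rw [Finset.card_eq_sum_card_fiberwise h]
    refine Finset.sum_congr rfl fun x hx => ?_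
    rw [← hT.card_filter_pairs x]
    symm
    refine Finset.card_bij (fun p _ => (x, p)) ?_ ?_ ?_
    · intro p hp
      have hx := (Finset.mem_filter.1 hx).2
      have hp := (Finset.mem_filter.1 hp).2
      exact Finset.mem_filter.2 ⟨Finset.mem_filter.2 ⟨Finset.mem_univ _, hp, hx⟩, rfl⟩
    · intro p _ q _ h
      exact (Prod.mk.inj h).2
    · rintro ⟨y, p⟩ hp
      obtain ⟨hp', rfl⟩ := Finset.mem_filter.1 hp
      exact ⟨p, Finset.mem_filter.2 ⟨Finset.mem_univ _, (Finset.mem_filter.1 hp').2.1⟩, rfl⟩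
  have hW : ∑ w ∈ W, 14 ≤ F.card := by
    calc ∑ w ∈ W, 14 ≤ ∑ w ∈ W, (senders G T w).card :=
          Finset.sum_le_sum fun w hw => hT.fourteen_le hH hmin (Finset.mem_filter.1 hw).2
      _ = (W.biUnion fun w => senders G T w).card := by
          rw [Finset.card_biUnion]
          intro w _ w' _ hne
          refine Finset.disjoint_left.2 fun f hf hf' => hne ?_
          rw [← (Finset.mem_filter.1 hf).2.2.2, (Finset.mem_filter.1 hf').2.2.2]
      _ ≤ F.card := by
          refine Finset.card_le_card (Finset.biUnion_subset.2 fun w _ f hf => ?_)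
          have := (Finset.mem_filter.1 hf).2
          exact Finset.mem_filter.2 ⟨Finset.mem_univ _, this.1, this.2.1⟩
  rw [hF, Finset.sum_filter, Finset.sum_filter] at hW
  have hv : ∀ v, (if 7 ≤ G.degree v then 2 * G.degree v else 0) + 84 ≤
      14 * G.degree v + if G.degree v = 5 then 14 else 0 := by
    intro v
    have := hmin v
    split_ifs <;> omega
  have := Finset.sum_le_sum fun v (_ : v ∈ Finset.univ) => hv v
  simp only [Finset.sum_add_distrib, ← Finset.mul_sum, Finset.sum_const, Finset.card_univ,
    smul_eq_mul] at this
  omega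

end IsTriangulatedSurface

/-! ### Crossings of a vertical ray with a segment -/

/-- An affine function that vanishes exactly on the line through `a` and `b` (if `a ≠ b`). -/
noncomputable def lineForm (a b q : Plane) : ℝ :=
  (b.1 - a.1) * (q.2 - a.2) - (b.2 - a.2) * (q.1 - a.1)

lemma continuous_lineForm (a b : Plane) : Continuous (lineForm a b) := by
  unfold lineForm
  fun_prop

open Classical in
/-- The number modulo 2 of crossings of the segment `ab` with the vertical ray upwards from `q`.
The abscissas of the points of the segment are taken as a half-open interval: the ends count as
lying to the right of `q` only if this holds strictly. -/
noncomputable def crossing (a b q : Plane) : ZMod 2 :=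
  if ((a.1 ≤ q.1 ∧ q.1 < b.1) ∨ (b.1 ≤ q.1 ∧ q.1 < a.1)) ∧ lineForm a b q * (b.1 - a.1) < 0
  then 1 else 0

open Classical in
/-- For `q'` near `q`, the contribution of an end `a` that lies vertically above `q` to the change
of the number of crossings: whether `a` is to the right of `q'`. -/
noncomputable def endJump (q a q' : Plane) : ZMod 2 :=
  if a.1 = q.1 ∧ q.2 < a.2 ∧ q'.1 < a.1 then 1 else 0

open Classical in
/-- Whether `q'` lies to the left of the line from `a` to `b`. -/
noncomputable def side (a b q' : Plane) : ZMod 2 :=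
  if 0 < lineForm a b q' then 1 else 0

lemma endJump_of_ne {q a : Plane} (h : a.1 ≠ q.1) (q' : Plane) : endJump q a q' = 0 :=
  if_neg fun h' => h h'.1

lemma lineForm_swap (a b q : Plane) : lineForm b a q = -lineForm a b q := by
  unfold lineForm
  ring

lemma crossing_swap (a b q : Plane) : crossing b a q = crossing a b q := by
  have : lineForm b a q * (a.1 - b.1) = lineForm a b q * (b.1 - a.1) := by
    rw [lineForm_swap]
    ring
  simp only [crossing, this, or_comm]

lemma exists_lineMap_eq_of_mem_segment {a b q : Plane} (h : q ∈ segment ℝ a b) (ha : q ≠ a)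
    (hb : q ≠ b) : ∃ t : ℝ, (0 < t ∧ t < 1) ∧ AffineMap.lineMap a b t = q := by
  rw [segment_eq_image_lineMap] at h
  obtain ⟨t, ⟨h0, h1⟩, rfl⟩ := h
  refine ⟨t, ⟨h0.lt_of_ne ?_, h1.lt_of_ne ?_⟩, rfl⟩
  · rintro rfl
    simp at ha
  · rintro rfl
    simp at hb

lemma sq_add_sq_pos_of_ne {a b : Plane} (h : a ≠ b) :
    0 < (b.1 - a.1) ^ 2 + (b.2 - a.2) ^ 2 := by
  by_contra hn
  apply h
  have h1 : b.1 - a.1 = 0 := by nlinarith [sq_nonneg (b.1 - a.1), sq_nonneg (b.2 - a.2)]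
  have h2 : b.2 - a.2 = 0 := by nlinarith [sq_nonneg (b.1 - a.1), sq_nonneg (b.2 - a.2)]
  ext <;> linarith

lemma mem_segment_of_lineForm_eq_zero {a b q : Plane} (ha : a.1 ≤ q.1) (hb : q.1 ≤ b.1)
    (hab : a.1 < b.1) (h : lineForm a b q = 0) : q ∈ segment ℝ a b := by
  have h' : 0 < b.1 - a.1 := by linarith
  rw [segment_eq_image_lineMap]
  refine ⟨(q.1 - a.1) / (b.1 - a.1), ⟨by apply div_nonneg <;> linarith,
    by rw [div_le_one h']; linarith⟩, ?_⟩
  unfold lineForm at h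
  ext
  · simp [AffineMap.lineMap_apply, h'.ne']
  · simp [AffineMap.lineMap_apply]
    field_simp
    linarith

lemma mem_segment_of_vertical {a b q : Plane} (ha : a.1 = q.1) (hb : b.1 = q.1)
    (ha' : a.2 ≤ q.2) (hb' : q.2 ≤ b.2) : q ∈ segment ℝ a b := by
  obtain ⟨x, y⟩ := q
  obtain ⟨a1, a2⟩ := a
  obtain ⟨b1, b2⟩ := b
  simp only at ha hb ha' hb'
  subst ha hb
  rcases eq_or_lt_of_le (ha'.trans hb') with h | h
  · have : y = a2 := by linarith
    subst this h
    simp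
  · have h' : 0 < b2 - a2 := by linarith
    rw [segment_eq_image_lineMap]
    refine ⟨(y - a2) / (b2 - a2), ⟨by apply div_nonneg <;> linarith,
      by rw [div_le_one h']; linarith⟩, ?_⟩
    ext
    · simp [AffineMap.lineMap_apply]
    · simp [AffineMap.lineMap_apply, h'.ne']

lemma lineForm_eq_zero_of_mem_segment {a b q : Plane} (h : q ∈ segment ℝ a b) :
    lineForm a b q = 0 := by
  rw [segment_eq_image_lineMap] at h
  obtain ⟨t, -, rfl⟩ := h
  simp [lineForm, AffineMap.lineMap_apply]
  ring

open Filter Topology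

lemma eventually_fst_lt {q : Plane} {r : ℝ} (h : q.1 < r) : ∀ᶠ q' : Plane in 𝓝 q, q'.1 < r :=
  continuous_fst.continuousAt.eventually_lt continuousAt_const h

lemma eventually_lt_fst {q : Plane} {r : ℝ} (h : r < q.1) : ∀ᶠ q' : Plane in 𝓝 q, r < q'.1 :=
  continuousAt_const.eventually_lt continuous_fst.continuousAt h

/-- Away from its zeros, the sign of `lineForm` is locally constant. -/
lemma eventually_lineForm_neg_iff {a b q : Plane} (h : lineForm a b q ≠ 0) :
    ∀ᶠ q' in 𝓝 q, (lineForm a b q' < 0 ↔ lineForm a b q < 0) := by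
  rcases lt_or_gt_of_ne h with h | h
  · filter_upwards [(continuous_lineForm a b).continuousAt.eventually_lt continuousAt_const h]
      with q' hq'
    exact iff_of_true hq' h
  · filter_upwards [continuousAt_const.eventually_lt (continuous_lineForm a b).continuousAt h]
      with q' hq'
    exact iff_of_false (not_lt.2 (le_of_lt hq')) (not_lt.2 (le_of_lt h))

lemma crossing_of_lt {a b : Plane} (hab : a.1 < b.1) (q : Plane) [Decidable
    ((a.1 ≤ q.1 ∧ q.1 < b.1) ∧ lineForm a b q < 0)] :
    crossing a b q = if (a.1 ≤ q.1 ∧ q.1 < b.1) ∧ lineForm a b q < 0 then 1 else 0 := by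
  unfold crossing
  refine if_congr ?_ rfl rfl
  rw [← neg_pos, ← neg_mul, mul_pos_iff_of_pos_right (sub_pos.2 hab), neg_pos]
  refine and_congr_left fun _ => ⟨fun h => h.resolve_right ?_, .inl⟩
  rintro ⟨h1, h2⟩
  linarith

lemma crossing_of_eq {a b : Plane} (hab : a.1 = b.1) (q : Plane) : crossing a b q = 0 := by
  simp [crossing, hab]

/-- Away from the segment `ab` the number of crossings is locally constant up to the contributions
of the ends. -/
lemma eventually_crossing_off {a b q : Plane} (h : q ∉ segment ℝ a b) :
    ∃ k : ZMod 2, ∀ᶠ q' in 𝓝 q, crossing a b q' = k + endJump q a q' + endJump q b q' := by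
  wlog hab : a.1 ≤ b.1 generalizing a b with H
  · obtain ⟨k, hk⟩ := H (a := b) (b := a) (by rwa [segment_symm]) (by linarith)
    refine ⟨k, hk.mono fun q' h => ?_⟩
    rw [← crossing_swap, h]
    ring
  have two : (1 : ZMod 2) + 1 = 0 := rfl
  rcases hab.eq_or_lt with hab | hab
  · refine ⟨0, Eventually.of_forall fun q' => ?_⟩
    rw [crossing_of_eq hab]
    unfold endJump
    by_cases haq : a.1 = q.1
    · have hiff : q.2 < a.2 ↔ q.2 < b.2 := by
        by_contra hne
        apply h
        rcases lt_or_ge q.2 a.2 with h1 | h1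
        · rw [segment_symm]
          exact mem_segment_of_vertical (by linarith) haq (by grind) h1.le
        · exact mem_segment_of_vertical haq (by linarith) h1 (by grind)
      simp only [← hab, hiff]
      split_ifs <;> simp [two]
    · rw [if_neg (by tauto), if_neg (by rw [← hab]; tauto)]
      simp
  · rcases lt_trichotomy q.1 a.1 with h1 | h1 | h1
    · refine ⟨0, (eventually_fst_lt h1).mono fun q' h2 => ?_⟩
      rw [crossing_of_lt hab, if_neg (by grind), endJump_of_ne h1.ne',
        endJump_of_ne (h1.trans hab).ne']
      simp
    · have hl : lineForm a b q ≠ 0 := fun h0 =>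
        h (mem_segment_of_lineForm_eq_zero h1.ge (h1.le.trans hab.le) hab h0)
      have hl' : lineForm a b q < 0 ↔ q.2 < a.2 := by
        have : lineForm a b q = (b.1 - a.1) * (q.2 - a.2) := by
          rw [lineForm, h1]
          ring
        rw [this, ← neg_pos, ← mul_neg, mul_pos_iff_of_pos_left (sub_pos.2 hab)]
        simp
      refine ⟨if q.2 < a.2 then 1 else 0, ?_⟩
      filter_upwards [eventually_fst_lt (h1.le.trans_lt hab), eventually_lineForm_neg_iff hl]
        with q' h2 h3
      rw [endJump_of_ne (h1.trans_lt hab).ne' q']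
      simp only [crossing_of_lt hab, h3, hl', endJump]
      by_cases h4 : q.2 < a.2 <;> by_cases h5 : q'.1 < a.1 <;>
        simp [h4, h5, h1, h2, two, not_le.2, not_lt.1]
    rcases lt_trichotomy q.1 b.1 with h2 | h2 | h2
    · have hl : lineForm a b q ≠ 0 := fun h0 =>
        h (mem_segment_of_lineForm_eq_zero h1.le h2.le hab h0)
      refine ⟨if lineForm a b q < 0 then 1 else 0, ?_⟩
      filter_upwards [eventually_fst_lt h2, eventually_lt_fst h1, eventually_lineForm_neg_iff hl]
        with q' h3 h4 h5
      simp only [crossing_of_lt hab, h5, endJump_of_ne h1.ne, endJump_of_ne h2.ne']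
      simp [h3, h4.le]
    · have hl : lineForm a b q ≠ 0 := fun h0 =>
        h (mem_segment_of_lineForm_eq_zero h1.le h2.le hab h0)
      have hl' : lineForm a b q < 0 ↔ q.2 < b.2 := by
        have : lineForm a b q = (b.1 - a.1) * (q.2 - b.2) := by
          rw [lineForm, h2]
          ring
        rw [this, ← neg_pos, ← mul_neg, mul_pos_iff_of_pos_left (sub_pos.2 hab)]
        simp
      refine ⟨0, ?_⟩
      filter_upwards [eventually_lt_fst h1, eventually_lineForm_neg_iff hl]
        with q' h4 h3
      rw [endJump_of_ne h1.ne q']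
      simp only [crossing_of_lt hab, h3, hl', endJump]
      by_cases h6 : q.2 < b.2 <;> by_cases h5 : q'.1 < b.1 <;>
        simp [h6, h5, h2, h4.le]
    · refine ⟨0, (eventually_lt_fst h2).mono fun q' h3 => ?_⟩
      rw [crossing_of_lt hab, if_neg (by grind), endJump_of_ne h1.ne, endJump_of_ne h2.ne]
      simp

/-- At an inner point of the segment `ab` the number of crossings is locally constant up to the
contributions of the ends and the side of the segment. -/
lemma eventually_crossing_on {a b q : Plane} (h : q ∈ segment ℝ a b) (ha : q ≠ a) (hb : q ≠ b) :
    ∃ k : ZMod 2, ∀ᶠ q' in 𝓝 q, lineForm a b q' ≠ 0 →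
      crossing a b q' = k + endJump q a q' + endJump q b q' + side a b q' := by
  have two : (1 : ZMod 2) + 1 = 0 := rfl
  wlog hab : a.1 < b.1 ∨ a.1 = b.1 ∧ a.2 ≤ b.2 generalizing a b with H
  · obtain ⟨k, hk⟩ := H (a := b) (b := a) (by rwa [segment_symm]) hb ha (by grind)
    refine ⟨k + 1, hk.mono fun q' h h0 => ?_⟩
    rw [← crossing_swap, h (by rwa [lineForm_swap, neg_ne_zero])]
    have : side b a q' = side a b q' + 1 := by
      unfold side
      rw [lineForm_swap]
      rcases lt_or_gt_of_ne h0 with h | h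
      · simp [h, h.le]
      · simp [h, h.le, two]
    rw [this]
    ring
  obtain ⟨t, ⟨ht0, ht1⟩, rfl⟩ := exists_lineMap_eq_of_mem_segment h ha hb
  set q := AffineMap.lineMap a b t with hq
  have e1 : q.1 = a.1 + t * (b.1 - a.1) := by
    simp [hq, AffineMap.lineMap_apply]
    ring
  have e2 : q.2 = a.2 + t * (b.2 - a.2) := by
    simp [hq, AffineMap.lineMap_apply]
    ring
  clear_value q
  rcases hab with hab | ⟨hab, hab'⟩
  · have h1 : a.1 < q.1 := by nlinarith
    have h2 : q.1 < b.1 := by nlinarith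
    refine ⟨1, ?_⟩
    filter_upwards [eventually_fst_lt h2, eventually_lt_fst h1] with q' h3 h4 h5
    rw [crossing_of_lt hab, endJump_of_ne h1.ne, endJump_of_ne h2.ne', side]
    rcases lt_or_gt_of_ne h5 with h | h
    · simp [h, h.le, h3, h4.le]
    · simp [h, h.le, h3, h4.le, two]
  · have hab2 : a.2 < b.2 := hab'.lt_of_ne fun h' => ha (by
      ext
      · rw [e1, hab]; ring
      · rw [e2, h']; ring)
    have h1 : a.2 < q.2 := by nlinarith
    have h2 : q.2 < b.2 := by nlinarith
    have h3 : a.1 = q.1 := by rw [e1, hab]; ring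
    refine ⟨0, Eventually.of_forall fun q' h5 => ?_⟩
    have hl : 0 < lineForm a b q' ↔ q'.1 < b.1 := by
      have : lineForm a b q' = (b.2 - a.2) * (b.1 - q'.1) := by
        rw [lineForm, hab]
        ring
      rw [this, mul_pos_iff_of_pos_left (sub_pos.2 hab2), sub_pos]
    have ha0 : endJump q a q' = 0 := if_neg fun h => h1.not_gt h.2.1
    have h4 : b.1 = q.1 := hab.symm.trans h3
    rw [crossing_of_eq hab, ha0]
    simp only [endJump, side, hl]
    by_cases h6 : q'.1 < b.1
    · rw [if_pos ⟨h4, h2, h6⟩, if_pos h6]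
      simp [two]
    · rw [if_neg (by tauto), if_neg h6]
      simp

/-! ### Segments of a drawing -/

lemma segment_infinite {a b : Plane} (h : a ≠ b) : (segment ℝ a b).Infinite := by
  rw [segment_eq_image_lineMap]
  exact (Set.Icc_infinite zero_lt_one).image (AffineMap.lineMap_injective ℝ h).injOn

lemma convex_lineForm_pos (a b : Plane) : Convex ℝ {q | 0 < lineForm a b q} := by
  have h : IsLinearMap ℝ fun q : Plane => (b.1 - a.1) * q.2 - (b.2 - a.2) * q.1 := by
    constructor
    · intro x y
      simp
      ring
    · intro c x
      simp
      ring
  have h' : {q | 0 < lineForm a b q} = {q : Plane | (b.1 - a.1) * a.2 - (b.2 - a.2) * a.1 <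
      (b.1 - a.1) * q.2 - (b.2 - a.2) * q.1} := by
    ext q
    simp only [Set.mem_ofPred_eq, lineForm]
    constructor <;> intro h <;> linarith
  rw [h']
  exact convex_halfSpace_gt h _

lemma convex_lineForm_neg (a b : Plane) : Convex ℝ {q | lineForm a b q < 0} := by
  simpa only [lineForm_swap a b, neg_pos] using convex_lineForm_pos b a

/-- Near an inner point of a segment, the line of the segment does not leave the segment. -/
lemma eventually_mem_segment {a b q : Plane} (h : q ∈ segment ℝ a b) (ha : q ≠ a) (hb : q ≠ b) :
    ∀ᶠ q' in 𝓝 q, lineForm a b q' = 0 → q' ∈ segment ℝ a b := by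
  obtain ⟨t, ⟨ht0, ht1⟩, htq⟩ := exists_lineMap_eq_of_mem_segment h ha hb
  have hne : a ≠ b := by
    rintro rfl
    simp at htq
    exact ha htq.symm
  have hpos := sq_add_sq_pos_of_ne hne
  -- The parameter of the orthogonal projection to the line.
  let s : Plane → ℝ := fun q' => ((q'.1 - a.1) * (b.1 - a.1) + (q'.2 - a.2) * (b.2 - a.2)) /
    ((b.1 - a.1) ^ 2 + (b.2 - a.2) ^ 2)
  have hs : Continuous s := by fun_prop
  have hsq : s q = t := by
    simp only [s, ← htq, AffineMap.lineMap_apply]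
    simp
    field_simp
  filter_upwards [hs.continuousAt.eventually_lt continuousAt_const (by rw [hsq]; exact ht1),
    continuousAt_const.eventually_lt hs.continuousAt (by rw [hsq]; exact ht0)] with q' h1 h0 hl
  rw [segment_eq_image_lineMap]
  refine ⟨s q', ⟨le_of_lt h0, le_of_lt h1⟩, ?_⟩
  unfold lineForm at hl
  have e1 : (b.1 - a.1) * s q' = q'.1 - a.1 := by
    simp only [s]
    field_simp
    linear_combination (b.2 - a.2) * hl
  have e2 : (b.2 - a.2) * s q' = q'.2 - a.2 := by
    simp only [s]
    field_simp
    linear_combination -(b.1 - a.1) * hl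
  ext
  · simp [AffineMap.lineMap_apply]
    linarith
  · simp [AffineMap.lineMap_apply]
    linarith

namespace PlaneDrawing

variable {V : Type*} {G : SimpleGraph V}

/-- A choice of an orientation and of a polygonal chain for every edge of a drawing. -/
structure Chains (D : PlaneDrawing G) where
  len : G.edgeSet → ℕ
  corner : G.edgeSet → ℕ → Plane
  src : G.edgeSet → V
  tgt : G.edgeSet → V
  edge_eq : ∀ e : G.edgeSet, (e : Sym2 V) = s(src e, tgt e)
  corner_zero : ∀ e, corner e 0 = D.point (src e)
  corner_len : ∀ e, corner e (len e) = D.point (tgt e)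
  len_pos : ∀ e, 0 < len e
  corner_ne : ∀ e, ∀ i < len e, corner e i ≠ corner e (i + 1)
  inter_succ : ∀ e i, i + 1 < len e →
    segment ℝ (corner e i) (corner e (i + 1)) ∩
      segment ℝ (corner e (i + 1)) (corner e (i + 2)) = {corner e (i + 1)}
  disjoint : ∀ e i j, i + 1 < j → j < len e →
    Disjoint (segment ℝ (corner e i) (corner e (i + 1)))
      (segment ℝ (corner e j) (corner e (j + 1)))
  arc_eq : ∀ e : G.edgeSet,
    D.arc e = ⋃ i ∈ Set.Iio (len e), segment ℝ (corner e i) (corner e (i + 1))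

lemma nonempty_chains (D : PlaneDrawing G) : Nonempty D.Chains := by
  have h : ∀ e : G.edgeSet, ∃ u v, (e : Sym2 V) = s(u, v) ∧
      IsPolygonalArc (D.arc e) (D.point u) (D.point v) := by
    rintro ⟨e, he⟩
    induction e using Sym2.ind with
    | h u v => exact ⟨u, v, rfl, D.isPolygonalArc u v he⟩
  choose src tgt hst n c h0 h1 h2 h3 h4 h5 h6 using h
  exact ⟨⟨n, c, src, tgt, hst, h1, h2, h0, h3, h4, h5, h6⟩⟩

namespace Chains

variable {D : PlaneDrawing G} (S : D.Chains)

/-- The `i`-th segment of the chain of `e`. -/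
abbrev seg (e : G.edgeSet) (i : ℕ) : Set Plane := segment ℝ (S.corner e i) (S.corner e (i + 1))

/-- The vertices and the corners of the edges of the drawing. -/
def bends : Set Plane := Set.range D.point ∪ ⋃ e, S.corner e '' Set.Iic (S.len e)

lemma bends_finite [Finite V] : S.bends.Finite := by
  classical
  have := Fintype.ofFinite V
  exact (Set.finite_range _).union (Set.finite_iUnion fun e => (Set.finite_Iic _).image _)

lemma point_mem_bends (v : V) : D.point v ∈ S.bends := .inl ⟨v, rfl⟩

lemma corner_mem_bends {e : G.edgeSet} {i : ℕ} (h : i ≤ S.len e) : S.corner e i ∈ S.bends :=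
  .inr (Set.mem_iUnion.2 ⟨e, i, h, rfl⟩)

lemma mem_arc {e : G.edgeSet} {q : Plane} : q ∈ D.arc e ↔ ∃ i < S.len e, q ∈ S.seg e i := by
  simp [S.arc_eq]

omit S in
lemma mem_support {q : Plane} : q ∈ D.support ↔
    q ∈ Set.range D.point ∨ ∃ e : G.edgeSet, q ∈ D.arc e := by
  simp [support]

lemma edge_eq_of_mem_arc {e f : G.edgeSet} {q : Plane} (hq : q ∉ S.bends) (he : q ∈ D.arc e)
    (hf : q ∈ D.arc f) : e = f := by
  by_contra hne
  obtain ⟨w, -, rfl⟩ := D.arc_inter_arc e e.2 f f.2 (fun h => hne (Subtype.ext h)) ⟨he, hf⟩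
  exact hq (S.point_mem_bends w)

lemma seg_unique {e f : G.edgeSet} {i j : ℕ} {q : Plane} (hq : q ∉ S.bends) (hi : i < S.len e)
    (hj : j < S.len f) (he : q ∈ S.seg e i) (hf : q ∈ S.seg f j) : e = f ∧ i = j := by
  obtain rfl : e = f := S.edge_eq_of_mem_arc hq (S.mem_arc.2 ⟨i, hi, he⟩) (S.mem_arc.2 ⟨j, hj, hf⟩)
  refine ⟨rfl, ?_⟩
  by_contra hne
  wlog hij : i < j generalizing i j
  · exact this hj hf hi he (Ne.symm hne) (by omega)
  rcases (Nat.succ_le_of_lt hij).eq_or_lt with rfl | h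
  · have h1 := S.inter_succ e i hj
    have h2 : q ∈ ({S.corner e (i + 1)} : Set Plane) := h1 ▸ ⟨he, hf⟩
    exact hq (h2 ▸ S.corner_mem_bends hi)
  · exact Set.disjoint_left.1 (S.disjoint e i j h hj) he hf

lemma exists_mem_arc_not_mem_bends [Finite V] (e : G.edgeSet) : ∃ q ∈ D.arc e, q ∉ S.bends := by
  obtain ⟨q, hq, hqb⟩ := (segment_infinite (S.corner_ne e 0 (S.len_pos e))).exists_notMem_finite
    S.bends_finite
  exact ⟨q, S.mem_arc.2 ⟨0, S.len_pos e, hq⟩, hqb⟩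

lemma isClosed_seg (e : G.edgeSet) (i : ℕ) : IsClosed (S.seg e i) := by
  rw [seg, ← convexHull_pair]
  exact (Set.Finite.isClosed_convexHull ℝ (Set.toFinite _))

include S in
lemma isClosed_arc (e : G.edgeSet) : IsClosed (D.arc e) := by
  rw [S.arc_eq]
  exact (Set.finite_Iio _).isClosed_biUnion fun i _ => S.isClosed_seg e i

include S in
lemma isClosed_support [Finite V] : IsClosed D.support := by
  have : D.support = Set.range D.point ∪ ⋃ e : G.edgeSet, D.arc e := by
    ext q
    rw [mem_support]
    simp
  rw [this]
  exact (Set.finite_range _).isClosed.union (isClosed_iUnion_of_finite S.isClosed_arc)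

end Chains

end PlaneDrawing

namespace PlaneDrawing

variable {V : Type*} {G : SimpleGraph V}

namespace Chains

variable {D : PlaneDrawing G} (S : D.Chains)

/-! ### The parity function of a cycle -/

lemma sum_range_add_succ (f : ℕ → ZMod 2) (n : ℕ) :
    ∑ i ∈ Finset.range n, (f i + f (i + 1)) = f 0 + f n := by
  induction n with
  | zero => simp [CharTwo.add_self_eq_zero]
  | succ n ih =>
    rw [Finset.sum_range_succ, ih]
    linear_combination f n * (CharTwo.two_eq_zero (R := ZMod 2))

section

variable [Fintype V]

open Classical in
/-- The boundary of a 1-chain modulo 2. -/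
noncomputable def boundary (G : SimpleGraph V) : (G.edgeSet → ZMod 2) →ₗ[ZMod 2] (V → ZMod 2) where
  toFun z v := ∑ e : G.edgeSet, if v ∈ (e : Sym2 V) then z e else 0
  map_add' x y := by
    ext v
    simp only [Pi.add_apply, ← Finset.sum_add_distrib]
    exact Finset.sum_congr rfl fun e _ => by split_ifs <;> simp
  map_smul' c x := by
    ext v
    simp [Finset.mul_sum]

open Classical in
/-- The number modulo 2 of crossings of the vertical ray upwards from `q` with the edges in `z`. -/
noncomputable def parity : (G.edgeSet → ZMod 2) →ₗ[ZMod 2] (Plane → ZMod 2) where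
  toFun z q := ∑ e : G.edgeSet, z e *
    ∑ i ∈ Finset.range (S.len e), crossing (S.corner e i) (S.corner e (i + 1)) q
  map_add' x y := by
    ext v
    simp [← Finset.sum_add_distrib, add_mul]
  map_smul' c x := by
    ext v
    simp [Finset.mul_sum, mul_assoc]

open Classical in
lemma parity_apply (z : G.edgeSet → ZMod 2) (q : Plane) : S.parity z q = ∑ e : G.edgeSet, z e *
    ∑ i ∈ Finset.range (S.len e), crossing (S.corner e i) (S.corner e (i + 1)) q := rfl

omit [Fintype V] in
lemma src_ne_tgt (e : G.edgeSet) : S.src e ≠ S.tgt e := by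
  have h := e.2
  rw [S.edge_eq e] at h
  exact G.ne_of_adj h

open Classical in
/-- A function on the vertices sums to zero over the ends of the edges of a cycle. -/
lemma sum_ends_eq_zero {z : G.edgeSet → ZMod 2} (hz : boundary G z = 0) (h : V → ZMod 2) :
    ∑ e : G.edgeSet, z e * (h (S.src e) + h (S.tgt e)) = 0 := by
  have h1 : ∀ e : G.edgeSet, z e * (h (S.src e) + h (S.tgt e)) =
      ∑ v, h v * if v ∈ (e : Sym2 V) then z e else 0 := by
    intro e
    simp only [S.edge_eq e, Sym2.mem_iff, mul_ite, mul_zero]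
    have hv : ∀ v, (if v = S.src e ∨ v = S.tgt e then h v * z e else 0) =
        (if v = S.src e then h v * z e else 0) + if v = S.tgt e then h v * z e else 0 := by
      intro v
      by_cases h1 : v = S.src e
      · have h2 : v ≠ S.tgt e := h1 ▸ S.src_ne_tgt e
        rw [if_pos (.inl h1), if_pos h1, if_neg h2, add_zero]
      · simp only [h1, false_or, if_false, zero_add]
    rw [Finset.sum_congr rfl fun v _ => hv v, Finset.sum_add_distrib]
    simp only [Finset.sum_ite_eq', Finset.mem_univ, if_true]
    ring
  rw [Finset.sum_congr rfl fun e _ => h1 e, Finset.sum_comm]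
  refine Finset.sum_eq_zero fun v _ => ?_
  rw [← Finset.mul_sum]
  have : ∑ e : G.edgeSet, (if v ∈ (e : Sym2 V) then z e else 0) = boundary G z v := rfl
  rw [this, hz]
  simp

open Classical in
/-- The contributions of the ends of the segments cancel in a cycle: if on the set `P` the
crossings of all segments are locally described up to a constant by the ends and a function `g`,
then so is the parity function by `g` alone. -/
lemma eventually_parity {z : G.edgeSet → ZMod 2} (hz : boundary G z = 0) {q : Plane}
    (P : Plane → Prop) (g : G.edgeSet → ℕ → Plane → ZMod 2)
    (h : ∀ e, ∀ i < S.len e, ∃ k, ∀ᶠ q' in 𝓝 q, P q' →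
      crossing (S.corner e i) (S.corner e (i + 1)) q' =
        k + endJump q (S.corner e i) q' + endJump q (S.corner e (i + 1)) q' + g e i q') :
    ∃ k, ∀ᶠ q' in 𝓝 q, P q' → S.parity z q' =
      k + ∑ e : G.edgeSet, z e * ∑ i ∈ Finset.range (S.len e), g e i q' := by
  have h' : ∀ e i, ∃ k, i < S.len e → ∀ᶠ q' in 𝓝 q, P q' →
      crossing (S.corner e i) (S.corner e (i + 1)) q' =
        k + endJump q (S.corner e i) q' + endJump q (S.corner e (i + 1)) q' + g e i q' := by
    intro e i
    by_cases hi : i < S.len e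
    · obtain ⟨k, hk⟩ := h e i hi
      exact ⟨k, fun _ => hk⟩
    · exact ⟨0, fun h => absurd h hi⟩
  choose k hk using h'
  refine ⟨∑ e : G.edgeSet, z e * ∑ i ∈ Finset.range (S.len e), k e i, ?_⟩
  have hall : ∀ᶠ q' in 𝓝 q, ∀ e : G.edgeSet, ∀ i ∈ Finset.range (S.len e), P q' →
      crossing (S.corner e i) (S.corner e (i + 1)) q' =
        k e i + endJump q (S.corner e i) q' + endJump q (S.corner e (i + 1)) q' + g e i q' := by
    rw [eventually_all]
    intro e
    rw [eventually_all_finset]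
    exact fun i hi => hk e i (Finset.mem_range.1 hi)
  filter_upwards [hall] with q' hq' hP
  have hsum : ∀ e : G.edgeSet,
      ∑ i ∈ Finset.range (S.len e), crossing (S.corner e i) (S.corner e (i + 1)) q' =
      ∑ i ∈ Finset.range (S.len e), k e i +
        (endJump q (D.point (S.src e)) q' + endJump q (D.point (S.tgt e)) q') +
        ∑ i ∈ Finset.range (S.len e), g e i q' := by
    intro e
    rw [← S.corner_zero, ← S.corner_len,
      ← sum_range_add_succ (fun i => endJump q (S.corner e i) q'), ← Finset.sum_add_distrib,
      ← Finset.sum_add_distrib]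
    refine Finset.sum_congr rfl fun i hi => ?_
    rw [hq' e i hi hP]
    ring
  rw [parity_apply, Finset.sum_congr rfl fun e _ => by rw [hsum e]]
  have h0 := S.sum_ends_eq_zero hz fun v => endJump q (D.point v) q'
  simp only [mul_add, Finset.sum_add_distrib] at h0 ⊢
  rw [h0, add_zero]

/-- The parity function of a cycle is locally constant off the drawing. -/
lemma eventually_parity_eq {z : G.edgeSet → ZMod 2} (hz : boundary G z = 0) {q : Plane}
    (hq : q ∉ D.support) : ∀ᶠ q' in 𝓝 q, S.parity z q' = S.parity z q := by
  obtain ⟨k, hk⟩ := S.eventually_parity hz (q := q) (fun _ => True) (fun _ _ _ => 0) (by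
    intro e i hi
    obtain ⟨k, hk⟩ := eventually_crossing_off (a := S.corner e i) (b := S.corner e (i + 1))
      (q := q) fun h => hq (mem_support.2 (.inr ⟨e, S.mem_arc.2 ⟨i, hi, h⟩⟩))
    exact ⟨k, hk.mono fun q' h _ => by rw [h, add_zero]⟩)
  have h0 := hk.self_of_nhds trivial
  filter_upwards [hk] with q' h
  rw [h trivial, h0]

open Classical in
/-- The parity function of a cycle `z` changes by `z e` across a segment of the edge `e`. -/
lemma eventually_parity_side {z : G.edgeSet → ZMod 2} (hz : boundary G z = 0) {q : Plane}
    (hq : q ∉ S.bends) {e : G.edgeSet} {i : ℕ} (hi : i < S.len e) (he : q ∈ S.seg e i) :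
    ∃ k, ∀ᶠ q' in 𝓝 q, lineForm (S.corner e i) (S.corner e (i + 1)) q' ≠ 0 →
      S.parity z q' = k + z e * side (S.corner e i) (S.corner e (i + 1)) q' := by
  obtain ⟨k, hk⟩ := S.eventually_parity hz (q := q)
    (fun q' => lineForm (S.corner e i) (S.corner e (i + 1)) q' ≠ 0)
    (fun f j q' => if f = e ∧ j = i then side (S.corner e i) (S.corner e (i + 1)) q' else 0) (by
    intro f j hj
    by_cases h : q ∈ S.seg f j
    · obtain ⟨rfl, rfl⟩ := S.seg_unique hq hj hi h he
      obtain ⟨k, hk⟩ := eventually_crossing_on h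
        (fun h => hq (h ▸ S.corner_mem_bends hi.le)) (fun h => hq (h ▸ S.corner_mem_bends hi))
      exact ⟨k, hk.mono fun q' h h' => by rw [h h', if_pos ⟨rfl, rfl⟩]⟩
    · obtain ⟨k, hk⟩ := eventually_crossing_off h
      refine ⟨k, hk.mono fun q' h' _ => ?_⟩
      rw [h', if_neg, add_zero]
      rintro ⟨rfl, rfl⟩
      exact h he)
  refine ⟨k, hk.mono fun q' h h' => ?_⟩
  rw [h h', Finset.sum_eq_single e, Finset.sum_eq_single i]
  · simp
  · intro j _ hj
    rw [if_neg (by tauto)]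
  · intro h
    exact absurd (Finset.mem_range.2 hi) h
  · intro f _ hf
    rw [Finset.sum_eq_zero, mul_zero]
    intro j _
    rw [if_neg (by tauto)]
  · simp

end

end Chains

end PlaneDrawing

/-- A locally constant function is constant on a preconnected set. -/
lemma IsPreconnected.eq_of_eventually_eq {X Y : Type*} [TopologicalSpace X] {s : Set X}
    (hs : IsPreconnected s) {f : X → Y} (hf : ∀ x ∈ s, ∀ᶠ y in 𝓝[s] x, f y = f x) {x y : X}
    (hx : x ∈ s) (hy : y ∈ s) : f x = f y := by
  let _ : TopologicalSpace Y := ⊥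
  have : DiscreteTopology Y := ⟨rfl⟩
  refine hs.constant (f := f) (fun x hx => ?_) hx hy
  rw [ContinuousWithinAt, nhds_discrete, tendsto_pure]
  exact hf x hx

namespace PlaneDrawing

/-! ### Faces and edges -/

section Faces

variable {V : Type*} {G : SimpleGraph V} {D : PlaneDrawing G}

namespace IsFace

variable {F F' : Set Plane}

lemma subset_compl (hF : D.IsFace F) : F ⊆ D.supportᶜ := by
  obtain ⟨x, -, rfl⟩ := hF
  exact connectedComponentIn_subset _ _

lemma isPreconnected (hF : D.IsFace F) : IsPreconnected F := by
  obtain ⟨x, -, rfl⟩ := hF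
  exact isPreconnected_connectedComponentIn

lemma nonempty (hF : D.IsFace F) : F.Nonempty := by
  obtain ⟨x, hx, rfl⟩ := hF
  exact ⟨x, mem_connectedComponentIn hx⟩

lemma eq_of_mem (hF : D.IsFace F) (hF' : D.IsFace F') {x : Plane} (hx : x ∈ F) (hx' : x ∈ F') :
    F = F' := by
  obtain ⟨y, -, rfl⟩ := hF
  obtain ⟨z, -, rfl⟩ := hF'
  rw [connectedComponentIn_eq hx, connectedComponentIn_eq hx']

lemma isOpen [Finite V] (hF : D.IsFace F) : IsOpen F := by
  obtain ⟨S⟩ := D.nonempty_chains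
  obtain ⟨x, -, rfl⟩ := hF
  exact S.isClosed_support.isOpen_compl.connectedComponentIn

lemma mem_frontier_iff [Finite V] (hF : D.IsFace F) {q : Plane} (hq : q ∈ D.support) :
    q ∈ frontier F ↔ q ∈ closure F := by
  rw [hF.isOpen.frontier_eq, Set.mem_sdiff, and_iff_left]
  exact fun h => hF.subset_compl h hq

end IsFace

lemma isFace_connectedComponentIn {x : Plane} (hx : x ∉ D.support) :
    D.IsFace (connectedComponentIn D.supportᶜ x) := ⟨x, hx, rfl⟩

namespace Chains

variable [Fintype V] (S : D.Chains)

/-- The parity function of a cycle is constant on every face. -/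
lemma parity_eq_of_mem_face {z : G.edgeSet → ZMod 2} (hz : boundary G z = 0) {F : Set Plane}
    (hF : D.IsFace F) {x y : Plane} (hx : x ∈ F) (hy : y ∈ F) : S.parity z x = S.parity z y :=
  hF.isPreconnected.eq_of_eventually_eq (fun _ hq =>
    nhdsWithin_le_nhds (S.eventually_parity_eq hz (hF.subset_compl hq))) hx hy

open Classical in
/-- The two sides of an edge `e` at a point that is not a bend: near that point there are only the
edge and two faces, between which the parity function of a cycle `z` differs by `z e`. -/
lemma exists_sides {q : Plane} (hq : q ∉ S.bends) {e : G.edgeSet} (he : q ∈ D.arc e) :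
    ∃ F₁ F₂, D.IsFace F₁ ∧ D.IsFace F₂ ∧ q ∈ closure F₁ ∧ q ∈ closure F₂ ∧
      (∀ᶠ q' in 𝓝 q, q' ∈ F₁ ∨ q' ∈ F₂ ∨ q' ∈ D.arc e) ∧
      ∀ z, boundary G z = 0 → ∀ x₁ ∈ F₁, ∀ x₂ ∈ F₂, S.parity z x₁ + S.parity z x₂ = z e := by
  obtain ⟨i, hi, hqi⟩ := S.mem_arc.1 he
  set a := S.corner e i with ha
  set b := S.corner e (i + 1) with hb
  have hqa : q ≠ a := fun h => hq (h ▸ S.corner_mem_bends hi.le)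
  have hqb : q ≠ b := fun h => hq (h ▸ S.corner_mem_bends hi)
  have hab : a ≠ b := S.corner_ne e i hi
  -- Near `q` the drawing lies on the line `ab`.
  have hsupp : ∀ᶠ q' in 𝓝 q, q' ∈ D.support → lineForm a b q' = 0 := by
    have h1 : ∀ᶠ q' in 𝓝 q, q' ∉ Set.range D.point :=
      (Set.finite_range _).isClosed.isOpen_compl.eventually_mem fun h => hq (.inl h)
    have h2 : ∀ᶠ q' in 𝓝 q, ∀ f : G.edgeSet, ∀ j ∈ Finset.range (S.len f), q' ∈ S.seg f j →
        lineForm a b q' = 0 := by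
      rw [eventually_all]
      intro f
      rw [eventually_all_finset]
      intro j hj
      by_cases h : q ∈ S.seg f j
      · obtain ⟨rfl, rfl⟩ := S.seg_unique hq (Finset.mem_range.1 hj) hi h hqi
        exact Eventually.of_forall fun q' h' => lineForm_eq_zero_of_mem_segment h'
      · exact ((S.isClosed_seg f j).isOpen_compl.eventually_mem h).mono
          fun q' h' h'' => absurd h'' h'
    filter_upwards [h1, h2] with q' h1 h2 h
    obtain ⟨f, hf⟩ := (mem_support.1 h).resolve_left h1
    obtain ⟨j, hj, hj'⟩ := S.mem_arc.1 hf
    exact h2 f j (Finset.mem_range.2 hj) hj'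
  have hline := eventually_mem_segment hqi hqa hqb
  obtain ⟨r, hr, hball⟩ := Metric.eventually_nhds_iff_ball.1 (hsupp.and hline)
  set P := Metric.ball q r ∩ {q' | 0 < lineForm a b q'} with hP
  set N := Metric.ball q r ∩ {q' | lineForm a b q' < 0} with hN
  have hPc : P ⊆ D.supportᶜ := fun q' h h' => (ne_of_gt h.2) ((hball q' h.1).1 h')
  have hNc : N ⊆ D.supportᶜ := fun q' h h' => (ne_of_lt h.2) ((hball q' h.1).1 h')
  have hPp : IsPreconnected P :=
    ((convex_ball q r).inter (convex_lineForm_pos a b)).isPreconnected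
  have hNp : IsPreconnected N :=
    ((convex_ball q r).inter (convex_lineForm_neg a b)).isPreconnected
  -- Approach `q` from both sides along the normal `n` of the line.
  let n : Plane := (-(b.2 - a.2), b.1 - a.1)
  have hpos := sq_add_sq_pos_of_ne hab
  have hq0 : lineForm a b q = 0 := lineForm_eq_zero_of_mem_segment hqi
  have hn : ∀ t : ℝ, lineForm a b (q + t • n) = t * ((b.1 - a.1) ^ 2 + (b.2 - a.2) ^ 2) := by
    intro t
    unfold lineForm at hq0 ⊢
    simp only [n, Prod.fst_add, Prod.snd_add, Prod.smul_fst, Prod.smul_snd, smul_eq_mul]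
    linear_combination hq0
  have ht : Tendsto (fun t : ℝ => q + t • n) (𝓝 0) (𝓝 q) := by
    have : Continuous fun t : ℝ => q + t • n := by fun_prop
    simpa using this.tendsto 0
  have htP : Tendsto (fun t : ℝ => q + t • n) (𝓝[>] 0) (𝓝 q) := ht.mono_left nhdsWithin_le_nhds
  have htN : Tendsto (fun t : ℝ => q + t • n) (𝓝[<] 0) (𝓝 q) := ht.mono_left nhdsWithin_le_nhds
  have heP : ∀ᶠ t : ℝ in 𝓝[>] 0, q + t • n ∈ P := by
    filter_upwards [htP.eventually (Metric.ball_mem_nhds q hr), self_mem_nhdsWithin] with t h1 h2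
    exact ⟨h1, by simpa only [Set.mem_ofPred_eq, hn] using mul_pos h2 hpos⟩
  have heN : ∀ᶠ t : ℝ in 𝓝[<] 0, q + t • n ∈ N := by
    filter_upwards [htN.eventually (Metric.ball_mem_nhds q hr), self_mem_nhdsWithin] with t h1 h2
    exact ⟨h1, by simpa only [Set.mem_ofPred_eq, hn] using mul_neg_of_neg_of_pos h2 hpos⟩
  obtain ⟨t₁, ht₁⟩ := heP.exists
  obtain ⟨t₂, ht₂⟩ := heN.exists
  have hPF := hPp.subset_connectedComponentIn ht₁ hPc
  have hNF := hNp.subset_connectedComponentIn ht₂ hNc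
  have hF₁ := isFace_connectedComponentIn (hPc ht₁)
  have hF₂ := isFace_connectedComponentIn (hNc ht₂)
  refine ⟨_, _, hF₁, hF₂, ?_, ?_, ?_, ?_⟩
  · exact mem_closure_of_tendsto htP (heP.mono fun t h => hPF h)
  · exact mem_closure_of_tendsto htN (heN.mono fun t h => hNF h)
  · filter_upwards [Metric.ball_mem_nhds q hr] with q' hq'
    rcases lt_trichotomy (lineForm a b q') 0 with h | h | h
    · exact .inr (.inl (hNF ⟨hq', h⟩))
    · exact .inr (.inr (S.mem_arc.2 ⟨i, hi, (hball q' hq').2 h⟩))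
    · exact .inl (hPF ⟨hq', h⟩)
  · intro z hz x₁ hx₁ x₂ hx₂
    obtain ⟨k, hk⟩ := S.eventually_parity_side hz hq hi hqi
    obtain ⟨s₁, h₁, h₁'⟩ := (heP.and (htP.eventually hk)).exists
    obtain ⟨s₂, h₂, h₂'⟩ := (heN.and (htN.eventually hk)).exists
    have e₁ : side a b (q + s₁ • n) = 1 := if_pos h₁.2
    have e₂ : side a b (q + s₂ • n) = 0 := if_neg (not_lt.2 (le_of_lt h₂.2))
    rw [S.parity_eq_of_mem_face hz hF₁ hx₁ (hPF h₁), S.parity_eq_of_mem_face hz hF₂ hx₂ (hNF h₂),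
      h₁' (ne_of_gt h₁.2), h₂' (ne_of_lt h₂.2), e₁, e₂]
    linear_combination k * (CharTwo.two_eq_zero (R := ZMod 2))

end Chains

end Faces

end PlaneDrawing

namespace PlaneDrawing

section Triangulation

variable {V : Type*} {G : SimpleGraph V} {D : PlaneDrawing G} {F F' : Set Plane}

/-! ### Plane triangulations -/

namespace IsThreeFace

variable {u v w : V}

lemma swap (h : D.IsThreeFace F u v w) : D.IsThreeFace F v u w := by
  obtain ⟨hF, h1, h2, h3, h4⟩ := h
  refine ⟨hF, h1.symm, h3, h2, ?_⟩
  rw [h4, Set.union_right_comm, Sym2.eq_swap (a := u) (b := v)]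

lemma rot (h : D.IsThreeFace F u v w) : D.IsThreeFace F v w u := by
  obtain ⟨hF, h1, h2, h3, h4⟩ := h
  refine ⟨hF, h2, h3.symm, h1.symm, ?_⟩
  rw [h4, Sym2.eq_swap (a := w) (b := u), Sym2.eq_swap (a := v) (b := u)]
  ext
  simp only [Set.mem_union]
  tauto

lemma frontier_eq (h : D.IsThreeFace F u v w) : frontier F = ⋃ e : G.edgeSet,
    ⋃ (_ : (e : Sym2 V) ∈ ({s(u, v), s(v, w), s(u, w)} : Set (Sym2 V))), D.arc e := by
  obtain ⟨hF, h1, h2, h3, h4⟩ := h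
  rw [h4]
  ext q
  simp only [Set.mem_union, Set.mem_iUnion, Set.mem_insert_iff, Set.mem_singleton_iff,
    Subtype.exists, exists_prop]
  constructor
  · rintro ((h | h) | h)
    exacts [⟨_, h1, .inl rfl, h⟩, ⟨_, h2, .inr (.inl rfl), h⟩, ⟨_, h3, .inr (.inr rfl), h⟩]
  · rintro ⟨e, -, rfl | rfl | rfl, h⟩ <;> tauto

/-- The edges on the boundary of a 3-face are those of its triangle, as an edge that shares with
the triangle a point other than the bends belongs to the triangle. -/
lemma mem_closure_iff [Finite V] (h : D.IsThreeFace F u v w) (S : D.Chains) {q : Plane}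
    (hq : q ∉ S.bends) {e : G.edgeSet} (he : q ∈ D.arc e) :
    q ∈ closure F ↔ (e : Sym2 V) ∈ ({s(u, v), s(v, w), s(u, w)} : Set (Sym2 V)) := by
  rw [← h.1.mem_frontier_iff (Chains.mem_support.2 (.inr ⟨e, he⟩)), h.frontier_eq]
  simp only [Set.mem_iUnion]
  constructor
  · rintro ⟨f, hf, hqf⟩
    rwa [S.edge_eq_of_mem_arc hq he hqf]
  · exact fun he' => ⟨e, he', he⟩

lemma arc_subset_iff [Finite V] (h : D.IsThreeFace F u v w) (e : G.edgeSet) :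
    D.arc e ⊆ frontier F ↔ (e : Sym2 V) ∈ ({s(u, v), s(v, w), s(u, w)} : Set (Sym2 V)) := by
  constructor
  · intro he
    obtain ⟨S⟩ := D.nonempty_chains
    obtain ⟨q, hq, hqb⟩ := S.exists_mem_arc_not_mem_bends e
    exact (h.mem_closure_iff S hqb hq).1 (frontier_subset_closure (he hq))
  · intro he
    rw [h.frontier_eq]
    exact Set.subset_iUnion₂_of_subset e he subset_rfl

lemma exists_third [Finite V] {a b c : V} (h : D.IsThreeFace F a b c) (huv : G.Adj u v)
    (hs : D.arc s(u, v) ⊆ frontier F) : ∃ w, D.IsThreeFace F u v w := by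
  have := (h.arc_subset_iff ⟨s(u, v), huv⟩).1 hs
  simp only [Set.mem_insert_iff, Set.mem_singleton_iff, Sym2.eq_iff] at this
  rcases this with (⟨rfl, rfl⟩ | ⟨rfl, rfl⟩) | (⟨rfl, rfl⟩ | ⟨rfl, rfl⟩) |
    (⟨rfl, rfl⟩ | ⟨rfl, rfl⟩)
  exacts [⟨_, h⟩, ⟨_, h.swap⟩, ⟨_, h.rot⟩, ⟨_, h.rot.swap⟩, ⟨_, h.rot.rot.swap⟩, ⟨_, h.rot.rot⟩]

lemma arc_subset (h : D.IsThreeFace F u v w) : D.arc s(u, v) ⊆ frontier F := by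
  rw [h.2.2.2.2]
  exact fun q hq => .inl (.inl hq)

lemma third_unique [Finite V] {w' : V} (h : D.IsThreeFace F u v w)
    (h' : D.IsThreeFace F u v w') : w = w' := by
  have := (h'.arc_subset_iff ⟨s(v, w), h.2.2.1⟩).1 h.rot.arc_subset
  have h1 := h.2.1.ne
  have h2 := h.2.2.1.ne
  have h3 := h.2.2.2.1.ne
  simp only [Set.mem_insert_iff, Set.mem_singleton_iff, Sym2.eq_iff] at this
  grind

end IsThreeFace

open Classical in
/-- The three edges of a triangle form a cycle modulo 2. -/
lemma Chains.exists_boundary_eq_zero [Fintype V] {u v w : V} (huv : G.Adj u v) (hvw : G.Adj v w)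
    (huw : G.Adj u w) : ∃ z : G.edgeSet → ZMod 2, Chains.boundary G z = 0 ∧
      ∀ e : G.edgeSet, (e : Sym2 V) ∈ ({s(u, v), s(v, w), s(u, w)} : Set (Sym2 V)) → z e = 1 := by
  have hs : ∀ (f : G.edgeSet) (t : V), Chains.boundary G (Pi.single f 1) t =
      if t ∈ (f : Sym2 V) then 1 else 0 := by
    intro f t
    change ∑ e : G.edgeSet, (if t ∈ (e : Sym2 V) then _ else _) = _
    rw [Finset.sum_eq_single f]
    · simp
    · intro e _ he
      simp [he]
    · simp
  let e₁ : G.edgeSet := ⟨s(u, v), huv⟩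
  let e₂ : G.edgeSet := ⟨s(v, w), hvw⟩
  let e₃ : G.edgeSet := ⟨s(u, w), huw⟩
  have n1 := huv.ne
  have n2 := hvw.ne
  have n3 := huw.ne
  have n12 : e₁ ≠ e₂ := by simp [e₁, e₂]; grind
  have n13 : e₁ ≠ e₃ := by simp [e₁, e₃]; grind
  have n23 : e₂ ≠ e₃ := by simp [e₂, e₃]; grind
  refine ⟨Pi.single e₁ 1 + Pi.single e₂ 1 + Pi.single e₃ 1, ?_, ?_⟩
  · ext t
    have two : (1 : ZMod 2) + 1 = 0 := rfl
    simp only [map_add, Pi.add_apply, hs, e₁, e₂, e₃, Sym2.mem_iff, Pi.zero_apply]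
    by_cases h1 : t = u
    · subst h1
      simp [n1, n3, two]
    by_cases h2 : t = v
    · subst h2
      simp [n1.symm, n2, two]
    by_cases h3 : t = w
    · subst h3
      simp [n2.symm, n3.symm, two]
    · simp [h1, h2, h3]
  · intro e he
    obtain rfl | rfl | rfl : e = e₁ ∨ e = e₂ ∨ e = e₃ := by
      rcases he with h | h | h
      exacts [.inl (Subtype.ext h), .inr (.inl (Subtype.ext h)), .inr (.inr (Subtype.ext h))]
    · simp [n12, n13]
    · simp [n12.symm, n23]
    · simp [n13.symm, n23.symm]

/-- In a plane triangulation every edge lies on exactly two faces; near each of its points that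
is not a bend there is nothing else than these, and the parity function of a cycle `z` differs
between them by `z e`. -/
lemma IsTriangulation.exists_two_faces [Fintype V] (hT : D.IsTriangulation) (S : D.Chains)
    (e : G.edgeSet) : ∃ F₁ F₂, F₁ ≠ F₂ ∧
      (∀ F, (D.IsFace F ∧ D.arc e ⊆ frontier F) ↔ F = F₁ ∨ F = F₂) ∧
      (∀ q ∈ D.arc e, q ∉ S.bends → ∀ᶠ q' in 𝓝 q, q' ∈ F₁ ∨ q' ∈ F₂ ∨ q' ∈ D.arc e) ∧
      ∀ z, Chains.boundary G z = 0 → ∀ x₁ ∈ F₁, ∀ x₂ ∈ F₂,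
        S.parity z x₁ + S.parity z x₂ = z e := by
  have hcl : ∀ F, D.IsFace F → ∀ q ∈ D.arc e, q ∉ S.bends →
      (q ∈ closure F ↔ D.arc e ⊆ frontier F) := by
    intro F hF q hq hqb
    obtain ⟨u, v, w, h⟩ := hT F hF
    rw [h.mem_closure_iff S hqb hq, h.arc_subset_iff]
  have key : ∀ q ∈ D.arc e, q ∉ S.bends → ∃ F₁ F₂, F₁ ≠ F₂ ∧
      (∀ F, (D.IsFace F ∧ D.arc e ⊆ frontier F) ↔ F = F₁ ∨ F = F₂) ∧
      (∀ᶠ q' in 𝓝 q, q' ∈ F₁ ∨ q' ∈ F₂ ∨ q' ∈ D.arc e) ∧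
      ∀ z, Chains.boundary G z = 0 → ∀ x₁ ∈ F₁, ∀ x₂ ∈ F₂,
        S.parity z x₁ + S.parity z x₂ = z e := by
    intro q hq hqb
    obtain ⟨F₁, F₂, hF₁, hF₂, hq₁, hq₂, hloc, hpar⟩ := S.exists_sides hqb hq
    have hs₁ := (hcl F₁ hF₁ q hq hqb).1 hq₁
    have hs₂ := (hcl F₂ hF₂ q hq hqb).1 hq₂
    refine ⟨F₁, F₂, ?_, fun F => ⟨?_, ?_⟩, hloc, hpar⟩
    · -- The boundary of `F₁` is a cycle through `e`, so its parity function separates the sides.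
      rintro rfl
      obtain ⟨u, v, w, h⟩ := hT F₁ hF₁
      obtain ⟨z, hz, hze⟩ := Chains.exists_boundary_eq_zero h.2.1 h.2.2.1 h.2.2.2.1
      obtain ⟨x, hx⟩ := hF₁.nonempty
      have h0 := hpar z hz x hx x hx
      rw [CharTwo.add_self_eq_zero, hze e ((h.arc_subset_iff e).1 hs₁)] at h0
      exact zero_ne_one h0
    · rintro ⟨hF, hs⟩
      have hqF := (hcl F hF q hq hqb).2 hs
      obtain ⟨x, hx, hxF⟩ := mem_closure_iff_frequently.1 hqF |>.and_eventually hloc |>.exists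
      rcases hxF with h | h | h
      · exact .inl (hF.eq_of_mem hF₁ hx h)
      · exact .inr (hF.eq_of_mem hF₂ hx h)
      · exact absurd (Chains.mem_support.2 (.inr ⟨e, h⟩)) (hF.subset_compl hx)
    · rintro (rfl | rfl)
      exacts [⟨hF₁, hs₁⟩, ⟨hF₂, hs₂⟩]
  obtain ⟨q, hq, hqb⟩ := S.exists_mem_arc_not_mem_bends e
  obtain ⟨F₁, F₂, hne, hF, -, hpar⟩ := key q hq hqb
  refine ⟨F₁, F₂, hne, hF, fun p hp hpb => ?_, hpar⟩
  obtain ⟨K₁, K₂, hne', hK, hloc, -⟩ := key p hp hpb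
  have h1 := (hF K₁).1 ((hK K₁).2 (.inl rfl))
  have h2 := (hF K₂).1 ((hK K₂).2 (.inr rfl))
  refine hloc.mono fun x hx => ?_
  rcases h1 with rfl | rfl <;> rcases h2 with rfl | rfl <;> tauto

/-- Two faces with the same boundary triangle would, with that triangle, fill an open and closed
part of the plane without the bends, which is connected; so `G` would have no other edges. -/
lemma IsThreeFace.eq_of_same [Fintype V] (hT : D.IsTriangulation) {u v w t : V}
    (h : D.IsThreeFace F u v w) (h' : D.IsThreeFace F' u v w) (ht : G.Adj u t) (htv : t ≠ v)
    (htw : t ≠ w) : F = F' := by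
  by_contra hne
  obtain ⟨S⟩ := D.nonempty_chains
  set E₀ : Set (Sym2 V) := {s(u, v), s(v, w), s(u, w)} with hE₀
  let f : Plane → Prop := fun q => q ∈ F ∨ q ∈ F' ∨ ∃ e : G.edgeSet, (e : Sym2 V) ∈ E₀ ∧ q ∈ D.arc e
  have hconn : IsPreconnected S.bendsᶜ := by
    refine (S.bends_finite.countable.isPathConnected_compl_of_one_lt_rank ?_).isConnected.2
    rw [← Module.finrank_eq_rank]
    norm_num
  have hsupp : ∀ {q}, q ∉ D.support → (f q ↔ q ∈ F ∨ q ∈ F') := by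
    intro q hq
    have : ¬ ∃ e : G.edgeSet, (e : Sym2 V) ∈ E₀ ∧ q ∈ D.arc e :=
      fun ⟨e, _, he⟩ => hq (Chains.mem_support.2 (.inr ⟨e, he⟩))
    simp only [f, this, or_false]
  have harc : ∀ {q}, q ∉ S.bends → ∀ {e : G.edgeSet}, q ∈ D.arc e → (f q ↔ (e : Sym2 V) ∈ E₀) := by
    intro q hq e he
    have hqs : q ∈ D.support := Chains.mem_support.2 (.inr ⟨e, he⟩)
    constructor
    · rintro (hF | hF | ⟨e', he', hq'⟩)
      · exact absurd hqs (h.1.subset_compl hF)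
      · exact absurd hqs (h'.1.subset_compl hF)
      · rwa [S.edge_eq_of_mem_arc hq he hq']
    · exact fun h => .inr (.inr ⟨e, h, he⟩)
  have hloc : ∀ x ∈ S.bendsᶜ, ∀ᶠ y in 𝓝[S.bendsᶜ] x, f y = f x := by
    intro x hx
    by_cases hxs : x ∈ D.support
    · obtain ⟨e, he⟩ := (Chains.mem_support.1 hxs).resolve_left fun h => hx (.inl h)
      obtain ⟨K₁, K₂, -, hK, hnear, -⟩ := hT.exists_two_faces S e
      have hF := hK F
      have hF' := hK F'
      rw [h.arc_subset_iff] at hF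
      rw [h'.arc_subset_iff] at hF'
      have hK₁ := (hK K₁).2 (.inl rfl)
      have hK₂ := (hK K₂).2 (.inr rfl)
      filter_upwards [nhdsWithin_le_nhds (hnear x he hx), self_mem_nhdsWithin] with y hy hyb
      refine propext ?_
      rw [harc hx he]
      by_cases hys : y ∈ D.arc e
      · exact harc hyb hys
      have hyK : y ∈ K₁ ∨ y ∈ K₂ := by tauto
      have hy' : y ∉ D.support := by
        rcases hyK with h | h
        exacts [hK₁.1.subset_compl h, hK₂.1.subset_compl h]
      rw [hsupp hy']
      constructor
      · rintro (h0 | h0)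
        · refine (hF.2 ?_).2
          rcases hyK with h1 | h1
          exacts [.inl (h.1.eq_of_mem hK₁.1 h0 h1), .inr (h.1.eq_of_mem hK₂.1 h0 h1)]
        · refine (hF'.2 ?_).2
          rcases hyK with h1 | h1
          exacts [.inl (h'.1.eq_of_mem hK₁.1 h0 h1), .inr (h'.1.eq_of_mem hK₂.1 h0 h1)]
      · intro h0
        rcases hF.1 ⟨h.1, h0⟩ with rfl | rfl <;> rcases hF'.1 ⟨h'.1, h0⟩ with rfl | rfl <;> tauto
    · have hK := isFace_connectedComponentIn hxs
      have hxK := mem_connectedComponentIn (F := D.supportᶜ) hxs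
      filter_upwards [nhdsWithin_le_nhds (hK.isOpen.mem_nhds hxK)] with y hy
      refine propext ?_
      rw [hsupp hxs, hsupp (hK.subset_compl hy)]
      constructor
      · rintro (h0 | h0)
        · exact .inl (hK.eq_of_mem h.1 hy h0 ▸ hxK)
        · exact .inr (hK.eq_of_mem h'.1 hy h0 ▸ hxK)
      · rintro (h0 | h0)
        · exact .inl (hK.eq_of_mem h.1 hxK h0 ▸ hy)
        · exact .inr (hK.eq_of_mem h'.1 hxK h0 ▸ hy)
  obtain ⟨p, hp, hpb⟩ := S.exists_mem_arc_not_mem_bends ⟨s(u, v), h.2.1⟩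
  obtain ⟨q, hq, hqb⟩ := S.exists_mem_arc_not_mem_bends ⟨s(u, t), ht⟩
  have := hconn.eq_of_eventually_eq hloc hpb hqb
  rw [harc hpb hp, harc hqb hq] at this
  have h0 : s(u, t) ∈ E₀ := this ▸ (.inl rfl)
  have h1 := h.2.1.ne
  have h2 := ht.ne
  have h3 := h.2.2.2.1.ne
  simp only [hE₀, Set.mem_insert_iff, Set.mem_singleton_iff, Sym2.eq_iff] at h0
  grind

/-- The facial triangles of a plane triangulation of minimum degree at least 3. -/
lemma IsTriangulation.isTriangulatedSurface [Fintype V] [DecidableRel G.Adj]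
    (hT : D.IsTriangulation) (hdeg : ∀ v, 3 ≤ G.degree v) :
    IsTriangulatedSurface G fun u v w => ∃ F, D.IsThreeFace F u v w where
  adj := fun ⟨_, h⟩ => h.2.1
  swap := fun ⟨F, h⟩ => ⟨F, h.swap⟩
  rot := fun ⟨F, h⟩ => ⟨F, h.rot⟩
  two := by
    classical
    intro u v huv
    obtain ⟨S⟩ := D.nonempty_chains
    obtain ⟨F₁, F₂, hne, hF, -, -⟩ := hT.exists_two_faces S ⟨s(u, v), huv⟩
    have third : ∀ F, D.IsFace F ∧ D.arc s(u, v) ⊆ frontier F → ∃ w, D.IsThreeFace F u v w := by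
      rintro F ⟨hF, hs⟩
      obtain ⟨a, b, c, h⟩ := hT F hF
      exact h.exists_third huv hs
    obtain ⟨w, hw⟩ := third F₁ ((hF F₁).2 (.inl rfl))
    obtain ⟨x, hx⟩ := third F₂ ((hF F₂).2 (.inr rfl))
    refine ⟨w, x, ?_, ⟨F₁, hw⟩, ⟨F₂, hx⟩, ?_⟩
    · rintro rfl
      have h2 : ({v, w} : Finset V).card < (G.neighborFinset u).card := by
        rw [G.card_neighborFinset_eq_degree]
        exact (Finset.card_le_two.trans_lt (by norm_num)).trans_le (hdeg u)
      obtain ⟨t, ht, htn⟩ := Finset.exists_mem_notMem_of_card_lt_card h2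
      simp only [Finset.mem_insert, Finset.mem_singleton, not_or] at htn
      exact hne (hw.eq_of_same hT hx ((G.mem_neighborFinset _ _).1 ht) htn.1 htn.2)
    · rintro y ⟨F, hy⟩
      rcases (hF F).1 ⟨hy.1, hy.arc_subset⟩ with rfl | rfl
      exacts [.inl (hy.third_unique hw), .inr (hy.third_unique hx)]

open Classical in
/-- The number of edges is bounded by Euler's formula: the parity function embeds the cycle space
modulo 2 into the functions on the faces, and the constant function 1 is not attained. -/
lemma IsTriangulation.card_edges_lt [Fintype V] [Nonempty V] (hT : D.IsTriangulation) :
    Nat.card G.edgeSet < 3 * Fintype.card V := by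
  obtain ⟨S⟩ := D.nonempty_chains
  choose F₁ F₂ hne hF hloc hpar using hT.exists_two_faces S
  have hface₁ : ∀ e, D.IsFace (F₁ e) := fun e => ((hF e _).2 (.inl rfl)).1
  have hface₂ : ∀ e, D.IsFace (F₂ e) := fun e => ((hF e _).2 (.inr rfl)).1
  have hfin : Finite {F // D.IsFace F} := by
    have hsub : {F | D.IsFace F} ⊆ ⋃ e, {F₁ e, F₂ e} := by
      intro F hF'
      obtain ⟨u, v, w, h⟩ := hT F hF'
      exact Set.mem_iUnion.2 ⟨⟨s(u, v), h.2.1⟩, (hF _ F).1 ⟨hF', h.arc_subset⟩⟩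
    exact ((Set.finite_iUnion fun e => Set.toFinite _).subset hsub).to_subtype
  have := Fintype.ofFinite {F // D.IsFace F}
  rw [Nat.card_eq_fintype_card]
  rcases isEmpty_or_nonempty G.edgeSet with hE | ⟨⟨e₀⟩⟩
  · rw [Fintype.card_eq_zero]
    exact Nat.mul_pos (by norm_num) Fintype.card_pos
  -- Every face has three edges and every edge two faces.
  have h32 : 3 * Fintype.card {F // D.IsFace F} = 2 * Fintype.card G.edgeSet := by
    have hcount := Finset.sum_card_bipartiteAbove_eq_sum_card_bipartiteBelow
      (s := (Finset.univ : Finset {F // D.IsFace F})) (t := (Finset.univ : Finset G.edgeSet))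
      (fun (F : {F // D.IsFace F}) (e : G.edgeSet) => D.arc e ⊆ frontier F.1)
    have h3 : ∀ F ∈ (Finset.univ : Finset {F // D.IsFace F}),
        ((Finset.univ : Finset G.edgeSet).bipartiteAbove
          (fun (F : {F // D.IsFace F}) (e : G.edgeSet) => D.arc e ⊆ frontier F.1) F).card = 3 := by
      rintro ⟨F, hF⟩ -
      obtain ⟨u, v, w, h⟩ := hT F hF
      rw [Finset.card_eq_three]
      have n1 := h.2.1.ne
      have n2 := h.2.2.1.ne
      have n3 := h.2.2.2.1.ne
      refine ⟨⟨s(u, v), h.2.1⟩, ⟨s(v, w), h.2.2.1⟩, ⟨s(u, w), h.2.2.2.1⟩, ?_, ?_, ?_, ?_⟩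
      · simp; grind
      · simp; grind
      · simp; grind
      · ext e
        rw [Finset.mem_bipartiteAbove, h.arc_subset_iff]
        simp [Subtype.ext_iff]
    have h2 : ∀ e ∈ (Finset.univ : Finset G.edgeSet),
        ((Finset.univ : Finset {F // D.IsFace F}).bipartiteBelow
          (fun (F : {F // D.IsFace F}) (e : G.edgeSet) => D.arc e ⊆ frontier F.1) e).card = 2 := by
      intro e _
      rw [Finset.card_eq_two]
      refine ⟨⟨F₁ e, hface₁ e⟩, ⟨F₂ e, hface₂ e⟩, fun h => hne e (congrArg Subtype.val h), ?_⟩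
      ext ⟨F, hF'⟩
      rw [Finset.mem_bipartiteBelow]
      have := hF e F
      simp only [Finset.mem_univ, true_and, Finset.mem_insert, Finset.mem_singleton,
        Subtype.mk.injEq]
      tauto
    rw [Finset.sum_congr rfl h3, Finset.sum_congr rfl h2] at hcount
    simpa [mul_comm] using hcount
  choose rep hrep using fun F : {F // D.IsFace F} => F.2.nonempty
  let Z := LinearMap.ker (Chains.boundary G)
  let Ψ : Z →ₗ[ZMod 2] ({F // D.IsFace F} → ZMod 2) :=
    (LinearMap.funLeft (ZMod 2) (ZMod 2) rep).comp (S.parity.comp Z.subtype)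
  have hΨ : ∀ (z : Z) e, z.1 e = Ψ z ⟨F₁ e, hface₁ e⟩ + Ψ z ⟨F₂ e, hface₂ e⟩ := fun z e =>
    (hpar e z.1 z.2 _ (hrep ⟨F₁ e, hface₁ e⟩) _ (hrep ⟨F₂ e, hface₂ e⟩)).symm
  have hinj : Function.Injective Ψ := by
    rw [injective_iff_map_eq_zero]
    intro z hz
    ext e
    rw [hΨ z e, hz]
    simp
  have hlt : Module.finrank (ZMod 2) (LinearMap.range Ψ) < Fintype.card {F // D.IsFace F} := by
    rw [← Module.finrank_fintype_fun_eq_card (ZMod 2)]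
    refine Submodule.finrank_lt fun h => ?_
    obtain ⟨z, hz⟩ := LinearMap.range_eq_top.1 h 1
    have hz0 : z = 0 := by
      ext e
      rw [hΨ z e, hz]
      rfl
    rw [hz0, map_zero] at hz
    exact zero_ne_one (congrFun hz ⟨F₁ e₀, hface₁ e₀⟩)
  rw [LinearMap.finrank_range_of_inj hinj] at hlt
  have hrank := (Chains.boundary G).finrank_range_add_finrank_ker
  have hle := (LinearMap.range (Chains.boundary G)).finrank_le
  rw [Module.finrank_fintype_fun_eq_card] at hrank hle
  change Module.finrank (ZMod 2) (LinearMap.ker (Chains.boundary G)) < _ at hlt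
  omega

end Triangulation

end PlaneDrawing

theorem lemmaA {V : Type*} [Fintype V] (G : SimpleGraph V) [DecidableRel G.Adj]
    (D : PlaneDrawing G) (hT : D.IsTriangulation) (hdeg : G.minDegree = 5)
    (hsep : ¬ G.HasSeparatingThreeCycle) :
    D.ContainsH := by
  classical
  have hmin : ∀ v, 5 ≤ G.degree v := fun v => hdeg ▸ G.minDegree_le_degree v
  have hV : Nonempty V := by
    by_contra h
    rw [not_nonempty_iff] at h
    simp [SimpleGraph.minDegree] at hdeg
  have hE := hT.card_edges_lt
  have hsum : ∑ v, G.degree v < 6 * Fintype.card V := by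
    rw [G.sum_degrees_eq_twice_card_edges, SimpleGraph.edgeFinset_card,
      ← Nat.card_eq_fintype_card]
    omega
  have hS := hT.isTriangulatedSurface fun v => by have := hmin v; omega
  have hH := hS.not_avoidsH hmin hsum
  simp only [IsTriangulatedSurface.AvoidsH, not_forall, not_le] at hH
  obtain ⟨u, v, w, x, hwx, ⟨F, hF⟩, ⟨F', hF'⟩, hw, hx⟩ := hH
  refine ⟨u, v, w, x, F, F', ?_, hwx, hF, hF', hw, by omega⟩
  rintro rfl
  exact hwx (hF.third_unique hF')
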